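/- Let $I,J\subset\mathbb R$ be open intervals (possibly unbounded), let $\Omega=I\times J$ with variables $(t,s)\in I\times J$, and let $v\in L^4(\Omega)$ be a real-valued distributional solution of Burgers' equation $$v_t+\Big(\frac{v^2}{2}\Big)_s=0\quad\text{in }\mathcal D'(\Omega)$$ which belongs to $L^3(I,W^{1/3,3}(J))$ in the sense that $$\int_I\int_{J\times J}\frac{|v(t,s)-v(t,\sigma)|^3}{|s-\sigma|^2}\,ds\,d\sigma\,dt<\infty .$$ Then $v$ satisfies the additional balance law $$\Big(\frac{v^2}{2}\Big)_t+\Big(\frac{v^3}{3}\Big)_s=0\quad\text{in }\mathcal D'(\Omega),$$ and $v$ is a locally bounded entropy solution of Burgers' equation; that is, $v\in L^\infty_{\rm loc}(\Omega)$, and for every pair of locally Lipschitz functions $\eta,q:\mathbb R\to\mathbb R$ such that $q'(w)=w\,\eta'(w)$ for a.e. $w\in\mathbb R$ and $\eta$ is convex, one has $$(\eta(v))_t+(q(v))_s\le 0\quad\text{in }\mathcal D'(\Omega),$$ i.e. $\int_\Omega\big(\eta(v)\,\varphi_t+q(v)\,\varphi_s\big)\,ds\,dt\ge 0$ for every $\varphi\in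 C_c^\infty(\Omega)$ with $\varphi\ge 0$. -/

import Mathlib

open MeasureTheory Set TopologicalSpace
open scoped Distributions ENNReal

noncomputable section

/-!
Points of the plane are pairs `(t, s)` (time, space). Test functions on an open set `Ω` are the
elements of `𝓓(Ω, ℝ)`: smooth functions with compact support contained in `Ω`.
-/

/-- The open rectangle `I × J`. -/
def rect (I J : Opens ℝ) : Opens (ℝ × ℝ) :=
  ⟨(I : Set ℝ) ×ˢ (J : Set ℝ), I.isOpen.prod J.isOpen⟩

/-- Action of the distribution `a_t + b_s` on a test function `φ`, up to the sign:
`∫_Ω (a φ_t + b φ_s)`, that is, `-⟨a_t + b_s, φ⟩`. -/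
def weakPairing (Ω : Opens (ℝ × ℝ)) (a b : ℝ × ℝ → ℝ) (φ : 𝓓(Ω, ℝ)) : ℝ :=
  ∫ z in (Ω : Set (ℝ × ℝ)), (a z * fderiv ℝ φ z (1, 0) + b z * fderiv ℝ φ z (0, 1))

/-- `a_t + b_s = 0` in the sense of distributions on `Ω`, for `a, b ∈ L¹_loc(Ω)`. -/
structure WeakBalance (Ω : Opens (ℝ × ℝ)) (a b : ℝ × ℝ → ℝ) : Prop where
  locallyIntegrable_fst : LocallyIntegrableOn a (Ω : Set (ℝ × ℝ))
  locallyIntegrable_snd : LocallyIntegrableOn b (Ω : Set (ℝ × ℝ))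
  eq_zero : ∀ φ : 𝓓(Ω, ℝ), weakPairing Ω a b φ = 0

/-- `a_t + b_s ≤ 0` in the sense of distributions on `Ω`, for `a, b ∈ L¹_loc(Ω)`:
`⟨a_t + b_s, φ⟩ ≤ 0` for every nonnegative test function `φ`. -/
structure WeakBalanceLE (Ω : Opens (ℝ × ℝ)) (a b : ℝ × ℝ → ℝ) : Prop where
  locallyIntegrable_fst : LocallyIntegrableOn a (Ω : Set (ℝ × ℝ))
  locallyIntegrable_snd : LocallyIntegrableOn b (Ω : Set (ℝ × ℝ))
  nonneg : ∀ φ : 𝓓(Ω, ℝ), (∀ z, 0 ≤ φ z) → 0 ≤ weakPairing Ω a b φ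

/-- `v` solves Burgers' equation `v_t + (v²/2)_s = 0` in the sense of distributions on `Ω`. -/
def IsBurgersSolution (Ω : Opens (ℝ × ℝ)) (v : ℝ × ℝ → ℝ) : Prop :=
  WeakBalance Ω v (fun z => v z ^ 2 / 2)

/-- `v ∈ L^∞_loc(Ω)`. -/
def MemLInftyLoc (Ω : Opens (ℝ × ℝ)) (v : ℝ × ℝ → ℝ) : Prop :=
  ∀ K : Set (ℝ × ℝ), IsCompact K → K ⊆ Ω → MemLp v ∞ (volume.restrict K)

/-- Entropy - entropy flux pairs for Burgers' equation. Locally Lipschitz functions are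
differentiable almost everywhere, so the derivatives below are genuine ones. -/
structure IsEntropyPair (η q : ℝ → ℝ) : Prop where
  entropy_lipschitz : LocallyLipschitz η
  flux_lipschitz : LocallyLipschitz q
  deriv_flux : ∀ᵐ w : ℝ, deriv q w = w * deriv η w

/-- Locally bounded entropy solutions of Burgers' equation on `Ω`. -/
structure IsEntropySolution (Ω : Opens (ℝ × ℝ)) (v : ℝ × ℝ → ℝ) : Prop where
  locallyBounded : MemLInftyLoc Ω v
  isSolution : IsBurgersSolution Ω v
  entropy_le : ∀ η q : ℝ → ℝ, IsEntropyPair η q → ConvexOn ℝ univ η →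
    WeakBalanceLE Ω (fun z => η (v z)) (fun z => q (v z))

/-- The cube of the `L³(I, W^{1/3,3}(J))` seminorm:
`∫_I ∫_{J×J} |v(t,s) - v(t,σ)|³ / |s - σ|² ds dσ dt`, with values in `[0, ∞]`. -/
def timeSpaceEnergy (I J : Set ℝ) (v : ℝ × ℝ → ℝ) : ℝ≥0∞ :=
  ∫⁻ t in I, ∫⁻ p in J ×ˢ J, ‖v (t, p.1) - v (t, p.2)‖ₑ ^ 3 / ‖p.1 - p.2‖ₑ ^ 2

end

/-! Mollifying `v` over a box of size δ in time and ε in space gives `V` with `V_t + S_s = 0`, where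
`S` is the mollified `v²/2`. The chain rule for `η(V)`, with `h = η'`, then fails only through the
commutator `S - V²/2`, whose dangerous occurrence is multiplied by `h'(V) V_s`
(`integral_entropy_identity`). The commutator is bounded by averaged squared increments of `v`, and
`V_s` by ε⁻¹ times averaged increments, so their product is bounded by ε⁻¹ times averaged cubed
increments. This is the quantity that the `W^{1/3,3}` energy controls, and absolute continuity of
the energy integral makes it tend to zero. There is no quantitative regularity in time, but δ may be
chosen after ε (`exists_box_lintegral_le`). Hence the balance law holds with equality whenever `η'`
is smooth with compact support (`weakPairing_eq_zero_of_contDiff`); the compact support makes `η`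
and `q` globally Lipschitz although `v` is not yet known to be bounded.

By the layer-cake formula these laws are averages over ξ of the equation `(∂_t + ξ ∂_s) 1_{v > ξ} =
0`, which therefore holds for every ξ (`superlevelPairing_eq_zero`): each superlevel set is
invariant under translation along `(1, ξ)` (`ae_superlevel_translate`).

Local boundedness follows from this free transport. If `v > M` on a non-null set, following all
speeds between `M/2` and `M` forces `v > M/2` on a set of measure at least a constant times `1/M`,
against Chebyshev's inequality in `L⁴` when `M` is large (`exists_ae_abs_le`). Once `v` is locally
bounded, integrating the transport equations against `η'` gives all entropy balances, with equality
(`weakPairing_entropyPair_eq_zero`). -/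

/-! ### Translations in `L^p`, mollification and oscillation estimates. -/

section Tools

open Filter Topology
open scoped Convolution ContDiff

/-- Continuity of translations in `L^p`, in terms of `∫ |f(z - w) - f(z)|^p dz`. -/
theorem tendsto_lintegral_translate_sub {f : ℝ × ℝ → ℝ} (n : ℕ) (hn : 1 ≤ n)
    (hf : MemLp f n volume) :
    Tendsto (fun w : ℝ × ℝ => ∫⁻ z, ‖f (z - w) - f z‖ₑ ^ n) (𝓝 0) (𝓝 0) := by
  have : Fact ((1 : ℝ≥0∞) ≤ n) := ⟨by exact_mod_cast hn⟩
  have hn0 : n ≠ 0 := by omega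
  -- Currying makes `w ↦ (z ↦ z - w)` continuous into the compact-open topology, the form in which
  -- composition with measure-preserving maps is continuous in `L^p`.
  let g : C(ℝ × ℝ, C(ℝ × ℝ, ℝ × ℝ)) :=
    (ContinuousMap.mk (fun a : (ℝ × ℝ) × (ℝ × ℝ) => a.2 - a.1) (by fun_prop)).curry
  have hg : ∀ w, MeasurePreserving (g w) volume volume := fun w =>
    measurePreserving_sub_right volume w
  have hcont : Continuous (fun w => Lp.compMeasurePreserving (g w) (hg w) hf.toLp) :=
    Continuous.compMeasurePreservingLp continuous_const g.continuous hg
      (ENNReal.natCast_ne_top n)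
  have h0 := hcont.tendsto 0
  rw [tendsto_iff_edist_tendsto_0] at h0
  have h1 := ENNReal.Tendsto.pow (n := n) h0
  rw [zero_pow hn0] at h1
  refine h1.congr fun w => ?_
  rw [Lp.edist_def, eLpNorm_eq_lintegral_rpow_enorm_toReal (by simpa using hn0)
    (ENNReal.natCast_ne_top n), ← ENNReal.rpow_natCast, ← ENNReal.rpow_mul]
  have hne : (n : ℝ) ≠ 0 := by exact_mod_cast hn0
  simp only [ENNReal.toReal_natCast, one_div, inv_mul_cancel₀ hne, ENNReal.rpow_one,
    ENNReal.rpow_natCast]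
  refine lintegral_congr_ae ?_
  have e1 := Lp.coeFn_compMeasurePreserving hf.toLp (hg w)
  have e2 := Lp.coeFn_compMeasurePreserving hf.toLp (hg 0)
  have e3 := (hg w).quasiMeasurePreserving.ae_eq_comp hf.coeFn_toLp
  have e4 := (hg 0).quasiMeasurePreserving.ae_eq_comp hf.coeFn_toLp
  filter_upwards [e1, e2, e3, e4] with z h1 h2 h3 h4
  simp only [Pi.sub_apply, h1, h2, h3, h4]
  simp [g]

/-- The integral of a directional derivative of a compactly supported `C¹` function vanishes. -/
theorem integral_fderiv_apply_eq_zero {g : ℝ × ℝ → ℝ} (hg : ContDiff ℝ 1 g)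
    (hc : HasCompactSupport g) (e : ℝ × ℝ) : ∫ z, fderiv ℝ g z e = 0 := by
  have h1 : Integrable (fun z => fderiv ℝ g z e) :=
    ((hg.continuous_fderiv one_ne_zero).clm_apply continuous_const).integrable_of_hasCompactSupport
      (hc.fderiv_apply (𝕜 := ℝ) e)
  have h2 : Integrable g := hg.continuous.integrable_of_hasCompactSupport hc
  have := integral_mul_fderiv_eq_neg_fderiv_mul_of_integrable (μ := (volume : Measure (ℝ × ℝ)))
    (f := fun _ : ℝ × ℝ => (1 : ℝ)) (g := g) (v := e) (by simp) (by simpa using h1)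
    (by simpa using h2) (fun x _ => by fun_prop)
    (fun x _ => (hg.differentiable one_ne_zero).differentiableAt)
  simpa using this

/-- Convolution of `f` with the kernel `k`. -/
noncomputable def mollify (k f : ℝ × ℝ → ℝ) (z : ℝ × ℝ) : ℝ := ∫ w, f w * k (z - w)

theorem mollify_eq_convolution (k f : ℝ × ℝ → ℝ) :
    mollify k f = f ⋆[ContinuousLinearMap.mul ℝ ℝ, volume] k := by
  ext z; rfl

theorem mollify_eq_integral_sub (k f : ℝ × ℝ → ℝ) (z : ℝ × ℝ) :
    mollify k f z = ∫ w, f (z - w) * k w := by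
  rw [mollify_eq_convolution, convolution_eq_swap]; rfl

theorem contDiff_mollify {k f : ℝ × ℝ → ℝ} (hk : ContDiff ℝ ∞ k) (hc : HasCompactSupport k)
    (hf : LocallyIntegrable f) : ContDiff ℝ ∞ (mollify k f) := by
  rw [mollify_eq_convolution]
  exact hc.contDiff_convolution_right _ hf hk

theorem fderiv_mollify {k f : ℝ × ℝ → ℝ} (hk : ContDiff ℝ ∞ k) (hc : HasCompactSupport k)
    (hf : LocallyIntegrable f) (z e : ℝ × ℝ) :
    fderiv ℝ (mollify k f) z e = mollify (fun w => fderiv ℝ k w e) f z := by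
  rw [mollify_eq_convolution, mollify_eq_convolution,
    (hc.hasFDerivAt_convolution_right _ hf (hk.of_le (by simp)) z).fderiv,
    convolution_precompR_apply _ hf (hc.fderiv ℝ) (hk.continuous_fderiv (by simp))]

theorem integrable_translate_mul {k f : ℝ × ℝ → ℝ} (hk : Continuous k) (hc : HasCompactSupport k)
    (hf : LocallyIntegrable f) (z : ℝ × ℝ) : Integrable (fun w => f (z - w) * k w) := by
  have := (hc.convolutionExists_right (ContinuousLinearMap.mul ℝ ℝ) hf hk z).integrable_swap
  exact this

theorem enorm_integral_mul_le {k g : ℝ × ℝ → ℝ} {B : Set (ℝ × ℝ)} (hB : MeasurableSet B)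
    {c : ℝ≥0∞} (hkB : ∀ w, ‖k w‖ₑ ≤ B.indicator (fun _ => c) w) (hc : c ≠ ⊤) :
    ‖∫ w, g w * k w‖ₑ ≤ c * ∫⁻ w in B, ‖g w‖ₑ := by
  refine (enorm_integral_le_lintegral_enorm _).trans ?_
  rw [← lintegral_const_mul' _ _ hc, ← lintegral_indicator hB]
  refine lintegral_mono fun w => ?_
  rw [enorm_mul]
  by_cases hw : w ∈ B
  · have := hkB w
    rw [indicator_of_mem hw] at this ⊢
    rw [mul_comm]; gcongr
  · have := hkB w
    rw [indicator_of_notMem hw] at this ⊢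
    simp [nonpos_iff_eq_zero.1 this]

/-- A kernel of mean zero does not see the constant `f z`, which can thus be subtracted from `f`. It
is applied to the spatial derivative of a mollifier. -/
theorem enorm_mollify_le_of_integral_eq_zero {k f : ℝ × ℝ → ℝ} (hk : Continuous k)
    (hc : HasCompactSupport k) (hf : LocallyIntegrable f) (hk0 : ∫ w, k w = 0)
    {B : Set (ℝ × ℝ)} (hB : MeasurableSet B)
    {c : ℝ≥0∞} (hkB : ∀ w, ‖k w‖ₑ ≤ B.indicator (fun _ => c) w) (hctop : c ≠ ⊤) (z : ℝ × ℝ) :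
    ‖mollify k f z‖ₑ ≤ c * ∫⁻ w in B, ‖f (z - w) - f z‖ₑ := by
  have hki : Integrable k := hk.integrable_of_hasCompactSupport hc
  have : mollify k f z = ∫ w, (f (z - w) - f z) * k w := by
    simp_rw [sub_mul]
    rw [integral_sub (integrable_translate_mul hk hc hf z) (hki.const_mul _),
      integral_const_mul, hk0, mollify_eq_integral_sub, mul_zero, sub_zero]
  rw [this]
  exact enorm_integral_mul_le hB hkB hctop

theorem enorm_mollify_sub_le {k f : ℝ × ℝ → ℝ} (hk : Continuous k)
    (hc : HasCompactSupport k) (hf : LocallyIntegrable f) (hk1 : ∫ w, k w = 1)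
    {B : Set (ℝ × ℝ)} (hB : MeasurableSet B)
    {c : ℝ≥0∞} (hkB : ∀ w, ‖k w‖ₑ ≤ B.indicator (fun _ => c) w) (hctop : c ≠ ⊤) (z : ℝ × ℝ) :
    ‖mollify k f z - f z‖ₑ ≤ c * ∫⁻ w in B, ‖f (z - w) - f z‖ₑ := by
  have hki : Integrable k := hk.integrable_of_hasCompactSupport hc
  have : mollify k f z - f z = ∫ w, (f (z - w) - f z) * k w := by
    simp_rw [sub_mul]
    rw [integral_sub (integrable_translate_mul hk hc hf z) (hki.const_mul _),
      integral_const_mul, hk1, mollify_eq_integral_sub, mul_one]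
  rw [this]
  exact enorm_integral_mul_le hB hkB hctop

/-- The variance of `f` with respect to a probability kernel is controlled by the mean square
oscillation. -/
theorem enorm_mollify_sq_sub_sq_le {k f : ℝ × ℝ → ℝ} (hk : Continuous k)
    (hc : HasCompactSupport k) (hf : LocallyIntegrable f)
    (hf2 : LocallyIntegrable (fun z => f z ^ 2)) (hk1 : ∫ w, k w = 1) (hk0 : ∀ w, 0 ≤ k w)
    {B : Set (ℝ × ℝ)} (hB : MeasurableSet B)
    {c : ℝ≥0∞} (hkB : ∀ w, ‖k w‖ₑ ≤ B.indicator (fun _ => c) w) (hctop : c ≠ ⊤) (z : ℝ × ℝ) :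
    ‖mollify k (fun z => f z ^ 2) z - mollify k f z ^ 2‖ₑ
      ≤ c * ∫⁻ w in B, ‖f (z - w) - f z‖ₑ ^ 2 := by
  have hki : Integrable k := hk.integrable_of_hasCompactSupport hc
  have i1 := integrable_translate_mul hk hc hf z
  have i2 : Integrable (fun w => f (z - w) ^ 2 * k w) := integrable_translate_mul hk hc hf2 z
  -- The second moment about `a`. Taking `a = V` shows that the variance `W - V²` is nonnegative;
  -- taking `a = f z` bounds it above, the mean being the minimizing centre.
  have key : ∀ a : ℝ, ∫ w, (f (z - w) - a) ^ 2 * k w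
      = mollify k (fun z => f z ^ 2) z - 2 * a * mollify k f z + a ^ 2 := by
    intro a
    have : (fun w => (f (z - w) - a) ^ 2 * k w) = fun w =>
        (f (z - w) ^ 2 * k w - (2 * a) * (f (z - w) * k w)) + a ^ 2 * k w := by
      ext w; ring
    have i3 : Integrable (fun w => f (z - w) ^ 2 * k w - (2 * a) * (f (z - w) * k w)) :=
      i2.sub (i1.const_mul _)
    rw [this, integral_add i3 (hki.const_mul _), integral_sub i2 (i1.const_mul _), integral_const_mul, integral_const_mul, hk1,
      mollify_eq_integral_sub, mollify_eq_integral_sub, mul_one]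
  have hpos : ∀ a : ℝ, 0 ≤ ∫ w, (f (z - w) - a) ^ 2 * k w := fun a =>
    integral_nonneg fun w => mul_nonneg (sq_nonneg _) (hk0 w)
  set V := mollify k f z
  set W := mollify k (fun z => f z ^ 2) z
  have hD0 : 0 ≤ W - V ^ 2 := by
    have := hpos V; rw [key] at this; linarith
  have hD1 : W - V ^ 2 ≤ ∫ w, (f (z - w) - f z) ^ 2 * k w := by
    rw [key]; nlinarith [sq_nonneg (V - f z)]
  have h3 : ‖W - V ^ 2‖ₑ ≤ ‖∫ w, (f (z - w) - f z) ^ 2 * k w‖ₑ := by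
    rw [Real.enorm_eq_ofReal hD0, Real.enorm_eq_ofReal (hpos _)]
    exact ENNReal.ofReal_le_ofReal hD1
  refine h3.trans ((enorm_integral_mul_le hB hkB hctop).trans_eq ?_)
  simp_rw [enorm_pow]

/-- The product is at most the cube of the larger factor. -/
theorem ENNReal.mul_sq_le_add_pow_three (x y : ℝ≥0∞) : x * y ^ 2 ≤ x ^ 3 + y ^ 3 := by
  rcases le_total x y with h | h
  · calc x * y ^ 2 ≤ y * y ^ 2 := by gcongr
      _ = y ^ 3 := by ring
      _ ≤ _ := le_add_self
  · calc x * y ^ 2 ≤ x * x ^ 2 := by gcongr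
      _ = x ^ 3 := by ring
      _ ≤ _ := le_self_add

/-- `(∫ a) (∫ a²) ≤ 2 μ(univ) ∫ a³`. -/
theorem lintegral_mul_lintegral_sq_le {α : Type*} [MeasurableSpace α] (μ : Measure α)
    {a : α → ℝ≥0∞} (ha : Measurable a) :
    (∫⁻ x, a x ∂μ) * (∫⁻ x, a x ^ 2 ∂μ) ≤ 2 * μ univ * ∫⁻ x, a x ^ 3 ∂μ := by
  calc (∫⁻ x, a x ∂μ) * (∫⁻ x, a x ^ 2 ∂μ)
      = ∫⁻ x, ∫⁻ y, a x * a y ^ 2 ∂μ ∂μ := by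
        rw [← lintegral_mul_const _ ha]
        refine lintegral_congr fun x => ?_
        rw [lintegral_const_mul _ (ha.pow_const 2)]
    _ ≤ ∫⁻ x, ∫⁻ y, (a x ^ 3 + a y ^ 3) ∂μ ∂μ := by
        gcongr with x y; exact ENNReal.mul_sq_le_add_pow_three _ _
    _ = ∫⁻ x, (a x ^ 3 * μ univ + ∫⁻ y, a y ^ 3 ∂μ) ∂μ := by
        refine lintegral_congr fun x => ?_
        rw [lintegral_add_left measurable_const, lintegral_const]
    _ = 2 * μ univ * ∫⁻ x, a x ^ 3 ∂μ := by
        rw [lintegral_add_right _ measurable_const, lintegral_mul_const _ (ha.pow_const 3),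
          lintegral_const]
        ring

end Tools

/-! ### Anisotropic mollifiers and the entropy identity with commutator. -/

section Kernel

open Filter Topology
open scoped Convolution ContDiff

/-- The box `[-δ, δ] × [-ε, ε]`. -/
def box (δ ε : ℝ) : Set (ℝ × ℝ) := Icc (-δ) δ ×ˢ Icc (-ε) ε

theorem measurableSet_box (δ ε : ℝ) : MeasurableSet (box δ ε) :=
  measurableSet_Icc.prod measurableSet_Icc

theorem isCompact_box (δ ε : ℝ) : IsCompact (box δ ε) := isCompact_Icc.prod isCompact_Icc

theorem box_subset_closedBall {δ ε r : ℝ} (hδ : δ ≤ r) (hε : ε ≤ r) :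
    box δ ε ⊆ Metric.closedBall 0 r := by
  rintro ⟨a, b⟩ ⟨ha, hb⟩
  simp only [mem_closedBall_zero_iff, Prod.norm_def, Real.norm_eq_abs]
  exact max_le ((abs_le.2 ha).trans hδ) ((abs_le.2 hb).trans hε)

theorem volume_box {δ ε : ℝ} (hδ : 0 ≤ δ) :
    volume (box δ ε) = ENNReal.ofReal (4 * (δ * ε)) := by
  rw [box, Measure.volume_eq_prod, Measure.prod_prod, Real.volume_Icc, Real.volume_Icc,
    ← ENNReal.ofReal_mul (by linarith)]
  congr 1; ring

/-- A family of smooth probability kernels adapted to the boxes `[-δ, δ] × [-ε, ε]`. -/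
theorem exists_kernel : ∃ C : ℝ, 0 < C ∧ ∀ δ ε : ℝ, 0 < δ → 0 < ε → ∃ k : ℝ × ℝ → ℝ,
    ContDiff ℝ ∞ k ∧ HasCompactSupport k ∧ tsupport k ⊆ box δ ε ∧ (∀ w, 0 ≤ k w) ∧
    (∫ w, k w = 1) ∧
    (∀ w, ‖k w‖ₑ ≤ (box δ ε).indicator (fun _ => ENNReal.ofReal (C / (δ * ε))) w) ∧
    (∀ w, ‖fderiv ℝ k w (0, 1)‖ₑ
      ≤ (box δ ε).indicator (fun _ => ENNReal.ofReal (C / (δ * ε ^ 2))) w) := by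
  let b : ContDiffBump (0 : ℝ) := ⟨1 / 2, 1, by norm_num, by norm_num⟩
  let ρ : ℝ → ℝ := b.normed volume
  have hρs : ContDiff ℝ ∞ ρ := b.contDiff_normed
  have hρc : HasCompactSupport ρ := b.hasCompactSupport_normed
  have hρt : tsupport ρ = Metric.closedBall 0 1 := b.tsupport_normed_eq
  have hρ0 : ∀ x, 0 ≤ ρ x := b.nonneg_normed
  have hρ1 : ∫ x, ρ x = 1 := b.integral_normed
  obtain ⟨C₁, hC₁⟩ := hρs.continuous.bounded_above_of_compact_support hρc
  obtain ⟨C₂, hC₂⟩ := (hρs.continuous_deriv (by simp)).bounded_above_of_compact_support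
    (hρc.deriv)
  -- A common bound for the profile and its derivative. The kernel is a product of two rescaled
  -- profiles, so `M * M` serves for both estimates, the spatial derivative costing one more factor
  -- ε⁻¹.
  set M := max (max C₁ C₂) 1 with hM
  have hM1 : 1 ≤ M := le_max_right _ _
  have hM0 : 0 < M := by linarith
  have hb1 : ∀ x, |ρ x| ≤ M := fun x =>
    (hC₁ x).trans ((le_max_left _ _).trans (le_max_left _ _))
  have hb2 : ∀ x, |deriv ρ x| ≤ M := fun x =>
    (hC₂ x).trans ((le_max_right _ _).trans (le_max_left _ _))
  refine ⟨M * M, by positivity, fun δ ε hδ hε => ?_⟩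
  let k : ℝ × ℝ → ℝ := fun w => (δ⁻¹ * ρ (δ⁻¹ * w.1)) * (ε⁻¹ * ρ (ε⁻¹ * w.2))
  have hks : ContDiff ℝ ∞ k := by
    refine ContDiff.mul (contDiff_const.mul (hρs.comp (by fun_prop)))
      (contDiff_const.mul (hρs.comp (by fun_prop)))
  have hzero : ∀ r : ℝ, 0 < r → ∀ x, x ∉ Icc (-r) r → ρ (r⁻¹ * x) = 0 := by
    intro r hr x hx
    refine image_eq_zero_of_notMem_tsupport ?_
    rw [hρt, mem_closedBall_zero_iff, Real.norm_eq_abs, abs_mul, abs_of_pos (inv_pos.2 hr)]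
    intro h
    apply hx
    rw [inv_mul_le_iff₀ hr, mul_one] at h
    exact abs_le.1 h
  have hkz : ∀ w, w ∉ box δ ε → k w = 0 := by
    intro w hw
    simp only [box, mem_prod, not_and_or] at hw
    rcases hw with hw | hw
    · simp [k, hzero δ hδ _ hw]
    · simp [k, hzero ε hε _ hw]
  have hts : tsupport k ⊆ box δ ε := by
    refine closure_minimal ?_ (isCompact_box δ ε).isClosed
    intro w hw
    by_contra h
    exact hw (hkz w h)
  have hkc : HasCompactSupport k := HasCompactSupport.of_support_subset_isCompact
    (isCompact_box δ ε) ((subset_tsupport k).trans hts)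
  have hLHS : ∀ r : ℝ, 0 < r → ∫ x, r⁻¹ * ρ (r⁻¹ * x) = 1 := by
    intro r hr
    rw [integral_const_mul, Measure.integral_comp_mul_left, inv_inv, abs_of_pos hr, hρ1]
    simp [hr.ne']
  refine ⟨k, hks, hkc, hts, fun w => ?_, ?_, fun w => ?_, fun w => ?_⟩
  · have := hρ0 (δ⁻¹ * w.1); have := hρ0 (ε⁻¹ * w.2); simp only [k]; positivity
  · have := integral_prod_mul (μ := (volume : Measure ℝ)) (ν := (volume : Measure ℝ))
      (fun x => δ⁻¹ * ρ (δ⁻¹ * x)) (fun x => ε⁻¹ * ρ (ε⁻¹ * x))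
    rw [hLHS δ hδ, hLHS ε hε, mul_one] at this
    exact this
  · by_cases hw : w ∈ box δ ε
    · rw [indicator_of_mem hw, Real.enorm_eq_ofReal_abs]
      refine ENNReal.ofReal_le_ofReal ?_
      simp only [k, abs_mul, abs_of_pos (inv_pos.2 hδ), abs_of_pos (inv_pos.2 hε)]
      calc δ⁻¹ * |ρ (δ⁻¹ * w.1)| * (ε⁻¹ * |ρ (ε⁻¹ * w.2)|)
          ≤ δ⁻¹ * M * (ε⁻¹ * M) := by
            have := hb1 (δ⁻¹ * w.1); have := hb1 (ε⁻¹ * w.2); gcongr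
        _ = _ := by field_simp
    · rw [hkz w hw]; simp
  · by_cases hw : w ∈ box δ ε
    · rw [indicator_of_mem hw, Real.enorm_eq_ofReal_abs]
      refine ENNReal.ofReal_le_ofReal ?_
      have hd : HasDerivAt (fun y => k (w.1, y))
          ((δ⁻¹ * ρ (δ⁻¹ * w.1)) * (ε⁻¹ * (deriv ρ (ε⁻¹ * w.2) * ε⁻¹))) w.2 := by
        have h1 : HasDerivAt ρ (deriv ρ (ε⁻¹ * w.2)) (ε⁻¹ * w.2) :=
          (hρs.differentiable (by simp)).differentiableAt.hasDerivAt
        have h2 : HasDerivAt (fun y : ℝ => ε⁻¹ * y) ε⁻¹ w.2 := by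
          simpa using (hasDerivAt_id w.2).const_mul ε⁻¹
        exact ((h1.comp w.2 h2).const_mul ε⁻¹).const_mul (δ⁻¹ * ρ (δ⁻¹ * w.1))
      have hd2 : HasDerivAt (fun y => k (w.1, y)) (fderiv ℝ k w (0, 1)) w.2 := by
        have h1 : HasFDerivAt k (fderiv ℝ k w) (w.1, w.2) :=
          (hks.differentiable (by simp)).differentiableAt.hasFDerivAt
        have h2 : HasDerivAt (fun y : ℝ => (w.1, y)) ((0 : ℝ), (1 : ℝ)) w.2 :=
          (hasDerivAt_const _ _).prodMk (hasDerivAt_id _)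
        exact h1.comp_hasDerivAt w.2 h2
      rw [hd2.unique hd]
      simp only [abs_mul, abs_of_pos (inv_pos.2 hδ), abs_of_pos (inv_pos.2 hε)]
      calc δ⁻¹ * |ρ (δ⁻¹ * w.1)| * (ε⁻¹ * (|deriv ρ (ε⁻¹ * w.2)| * ε⁻¹))
          ≤ δ⁻¹ * M * (ε⁻¹ * (M * ε⁻¹)) := by
            have := hb1 (δ⁻¹ * w.1); have := hb2 (ε⁻¹ * w.2); gcongr
        _ = _ := by field_simp
    · have : fderiv ℝ k w = 0 :=
        image_eq_zero_of_notMem_tsupport (fun h => hw (hts (tsupport_fderiv_subset ℝ h)))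
      simp [this]

/-- Entropy identity for a smooth approximate solution `V_t + S_s = 0`. -/
theorem integral_entropy_identity {V S φ : ℝ × ℝ → ℝ} {η q h : ℝ → ℝ}
    (hV : ContDiff ℝ ∞ V) (hS : ContDiff ℝ ∞ S) (hφ : ContDiff ℝ ∞ φ) (hφc : HasCompactSupport φ)
    (hh : ContDiff ℝ ∞ h) (hη : ∀ x, HasDerivAt η (h x) x) (hq : ∀ x, HasDerivAt q (x * h x) x)
    (heq : ∀ z ∈ tsupport φ, fderiv ℝ V z (1, 0) + fderiv ℝ S z (0, 1) = 0) :
    Integrable (fun z => η (V z) * fderiv ℝ φ z (1, 0) + q (V z) * fderiv ℝ φ z (0, 1)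
      + (S z - V z ^ 2 / 2) * (deriv h (V z) * fderiv ℝ V z (0, 1) * φ z
        + h (V z) * fderiv ℝ φ z (0, 1))) ∧
    ∫ z, (η (V z) * fderiv ℝ φ z (1, 0) + q (V z) * fderiv ℝ φ z (0, 1)
      + (S z - V z ^ 2 / 2) * (deriv h (V z) * fderiv ℝ V z (0, 1) * φ z
        + h (V z) * fderiv ℝ φ z (0, 1))) = 0 := by
  have hηc : ContDiff ℝ 1 η := by
    rw [contDiff_one_iff_deriv]
    refine ⟨fun x => (hη x).differentiableAt, ?_⟩
    rw [show deriv η = h from funext fun x => (hη x).deriv]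
    exact hh.continuous
  have hqc : ContDiff ℝ 1 q := by
    rw [contDiff_one_iff_deriv]
    refine ⟨fun x => (hq x).differentiableAt, ?_⟩
    rw [show deriv q = fun x => x * h x from funext fun x => (hq x).deriv]
    exact continuous_id.mul hh.continuous
  have hV1 : ContDiff ℝ 1 V := hV.of_le (by simp)
  have hS1 : ContDiff ℝ 1 S := hS.of_le (by simp)
  have hφ1 : ContDiff ℝ 1 φ := hφ.of_le (by simp)
  have hh1 : ContDiff ℝ 1 h := hh.of_le (by simp)
  -- The flux in `B` carries the correction `h(V) (S - V²/2)`, so that the undifferentiated-φ terms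
  -- of `A_t + B_s` collapse to `h(V) (V_t + S_s) φ = 0` plus the commutator times `h'(V) V_s φ`.
  let A : ℝ × ℝ → ℝ := fun z => η (V z) * φ z
  let B : ℝ × ℝ → ℝ := fun z => (q (V z) + h (V z) * (S z - V z ^ 2 / 2)) * φ z
  have hA : ContDiff ℝ 1 A := (hηc.comp hV1).mul hφ1
  have hB : ContDiff ℝ 1 B := by
    refine ContDiff.mul ((hqc.comp hV1).add ((hh1.comp hV1).mul ?_)) hφ1
    exact hS1.sub ((hV1.pow 2).div_const 2)
  have hAc : HasCompactSupport A := hφc.mul_left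
  have hBc : HasCompactSupport B := hφc.mul_left
  have iA : Integrable (fun z => fderiv ℝ A z (1, 0)) :=
    ((hA.continuous_fderiv one_ne_zero).clm_apply continuous_const).integrable_of_hasCompactSupport
      (hAc.fderiv_apply (𝕜 := ℝ) _)
  have iB : Integrable (fun z => fderiv ℝ B z (0, 1)) :=
    ((hB.continuous_fderiv one_ne_zero).clm_apply continuous_const).integrable_of_hasCompactSupport
      (hBc.fderiv_apply (𝕜 := ℝ) _)
  have hfun : (fun z => η (V z) * fderiv ℝ φ z (1, 0) + q (V z) * fderiv ℝ φ z (0, 1)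
      + (S z - V z ^ 2 / 2) * (deriv h (V z) * fderiv ℝ V z (0, 1) * φ z
        + h (V z) * fderiv ℝ φ z (0, 1)))
      = fun z => fderiv ℝ A z (1, 0) + fderiv ℝ B z (0, 1) := by
    ext z
    have dV : HasFDerivAt V (fderiv ℝ V z) z :=
      (hV1.differentiable one_ne_zero).differentiableAt.hasFDerivAt
    have dS : HasFDerivAt S (fderiv ℝ S z) z :=
      (hS1.differentiable one_ne_zero).differentiableAt.hasFDerivAt
    have dφ : HasFDerivAt φ (fderiv ℝ φ z) z :=
      (hφ1.differentiable one_ne_zero).differentiableAt.hasFDerivAt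
    have dη : HasFDerivAt (fun z => η (V z)) (h (V z) • fderiv ℝ V z) z :=
      (hη (V z)).comp_hasFDerivAt z dV
    have dq : HasFDerivAt (fun z => q (V z)) ((V z * h (V z)) • fderiv ℝ V z) z :=
      (hq (V z)).comp_hasFDerivAt z dV
    have dh : HasFDerivAt (fun z => h (V z)) (deriv h (V z) • fderiv ℝ V z) z :=
      ((hh1.differentiable one_ne_zero).differentiableAt.hasDerivAt).comp_hasFDerivAt z dV
    have dV2 : HasFDerivAt (fun z => V z ^ 2 / 2) (V z • fderiv ℝ V z) z := by
      have : HasDerivAt (fun x : ℝ => x ^ 2 / 2) (V z) (V z) := by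
        refine ((hasDerivAt_pow 2 (V z)).div_const 2).congr_deriv ?_
        norm_num
      exact this.comp_hasFDerivAt z dV
    have dA : HasFDerivAt A _ z := dη.mul dφ
    have dB : HasFDerivAt B _ z := (dq.add (dh.mul (dS.sub dV2))).mul dφ
    rw [dA.fderiv, dB.fderiv]
    simp only [add_apply, smul_apply, sub_apply, Pi.add_apply, Pi.mul_apply, Pi.sub_apply,
      smul_eq_mul]
    by_cases hz : z ∈ tsupport φ
    · have := heq z hz
      linear_combination (- h (V z) * φ z) * this
    · have h0 : φ z = 0 := image_eq_zero_of_notMem_tsupport hz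
      rw [h0]; ring
  rw [hfun]
  refine ⟨iA.add iB, ?_⟩
  rw [integral_add iA iB, integral_fderiv_apply_eq_zero hA hAc,
    integral_fderiv_apply_eq_zero hB hBc, add_zero]

end Kernel

/-! ### Small averaged increments from finite energy, and the choice of scales. -/

section Smallness

open Filter Topology

/-- The spatial increments of `v` are controlled by the energy. -/
theorem lintegral_spatial_increment_le {I J : Opens ℝ} {v u : ℝ × ℝ → ℝ} (hv : Measurable v)
    {K : Set (ℝ × ℝ)} (hK : MeasurableSet K) {r : ℝ}
    (hKr : ∀ z ∈ K, ∀ y ∈ Icc (-r) r, z - (0, y) ∈ rect I J ∧ u (z - (0, y)) = v (z - (0, y))) :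
    ∫⁻ y in Icc (-r) r, (∫⁻ z in K, ‖u (z - (0, y)) - u z‖ₑ ^ 3) / ‖y‖ₑ ^ 2
      ≤ timeSpaceEnergy I J v := by
  classical
  let A : Set (ℝ × ℝ × ℝ) := (I : Set ℝ) ×ˢ (J : Set ℝ) ×ˢ (J : Set ℝ)
  have hA : MeasurableSet A := I.isOpen.measurableSet.prod
    (J.isOpen.measurableSet.prod J.isOpen.measurableSet)
  let G : ℝ × ℝ × ℝ → ℝ≥0∞ := A.indicator fun x =>
    ‖v (x.1, x.2.1) - v (x.1, x.2.2)‖ₑ ^ 3 / ‖x.2.1 - x.2.2‖ₑ ^ 2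
  have hG : Measurable G := by
    refine Measurable.indicator ?_ hA
    have h1 : Measurable fun x : ℝ × ℝ × ℝ => v (x.1, x.2.1) := hv.comp (by fun_prop)
    have h2 : Measurable fun x : ℝ × ℝ × ℝ => v (x.1, x.2.2) := hv.comp (by fun_prop)
    exact ((h1.sub h2).enorm.pow_const 3).div
      ((by fun_prop : Measurable fun x : ℝ × ℝ × ℝ => x.2.1 - x.2.2).enorm.pow_const 2)
  calc ∫⁻ y in Icc (-r) r, (∫⁻ z in K, ‖u (z - (0, y)) - u z‖ₑ ^ 3) / ‖y‖ₑ ^ 2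
      ≤ ∫⁻ y in Icc (-r) r, ∫⁻ z : ℝ × ℝ, G (z.1, z.2, z.2 - y) := by
        rw [← lintegral_indicator measurableSet_Icc, ← lintegral_indicator measurableSet_Icc]
        refine lintegral_mono fun y => ?_
        by_cases hy : y ∈ Icc (-r) r
        swap
        · simp [indicator_of_notMem hy]
        rw [indicator_of_mem hy, indicator_of_mem hy]
        -- At `y = 0` the increment vanishes and `0 / 0 = 0` in `ℝ≥0∞`.
        rcases eq_or_ne y 0 with rfl | hy0
        · have h0 : ∀ z : ℝ × ℝ, z - ((0 : ℝ), (0 : ℝ)) = z := fun z => by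
            ext <;> simp
          simp [h0]
        have hy2 : ‖y‖ₑ ^ 2 ≠ 0 := by simpa using hy0
        rw [ENNReal.div_eq_inv_mul, ← lintegral_const_mul' _ _ (ENNReal.inv_ne_top.2 hy2),
          ← lintegral_indicator hK]
        refine lintegral_mono fun z => ?_
        by_cases hz : z ∈ K
        swap
        · simp [indicator_of_notMem hz]
        rw [indicator_of_mem hz]
        obtain ⟨h1, h2⟩ := hKr z hz y hy
        have hr : (0 : ℝ) ∈ Icc (-r) r := ⟨by linarith [hy.1, hy.2], by linarith [hy.1, hy.2]⟩
        obtain ⟨h3, h4⟩ := hKr z hz 0 hr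
        have h0 : z - ((0 : ℝ), (0 : ℝ)) = z := by ext <;> simp
        rw [h0] at h3 h4
        have hmem : (z.1, z.2, z.2 - y) ∈ A := by
          refine ⟨h3.1, h3.2, ?_⟩
          exact h1.2
        have hz' : z - (0, y) = (z.1, z.2 - y) := by ext <;> simp
        simp only [G]
        rw [indicator_of_mem hmem, h2, h4, ← ENNReal.div_eq_inv_mul, hz', enorm_sub_rev]
        simp
    _ ≤ ∫⁻ y, ∫⁻ z : ℝ × ℝ, G (z.1, z.2, z.2 - y) := setLIntegral_le_lintegral _ _
    _ = ∫⁻ z : ℝ × ℝ, ∫⁻ y, G (z.1, z.2, z.2 - y) := by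
        refine lintegral_lintegral_swap ?_
        exact (hG.comp (by fun_prop : Measurable fun p : ℝ × ℝ × ℝ =>
          (p.2.1, p.2.2, p.2.2 - p.1))).aemeasurable
    -- The substitution `σ = s - y` turns the increment into the second space variable.
    _ = ∫⁻ z : ℝ × ℝ, ∫⁻ y, G (z.1, z.2, y) := by
        refine lintegral_congr fun z => ?_
        exact lintegral_sub_left_eq_self (fun y => G (z.1, z.2, y)) z.2
    _ = ∫⁻ t, ∫⁻ s, ∫⁻ y, G (t, s, y) := by
        rw [Measure.volume_eq_prod]
        refine lintegral_prod _ ?_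
        refine Measurable.aemeasurable ?_
        exact Measurable.lintegral_prod_right
          (hG.comp (by fun_prop : Measurable fun p : (ℝ × ℝ) × ℝ => (p.1.1, p.1.2, p.2)))
    _ = ∫⁻ t, ∫⁻ p : ℝ × ℝ, G (t, p) := by
        refine lintegral_congr fun t => ?_
        rw [Measure.volume_eq_prod]
        exact (lintegral_prod _ (hG.comp (by fun_prop)).aemeasurable).symm
    _ = timeSpaceEnergy I J v := by
        rw [timeSpaceEnergy, ← lintegral_indicator I.isOpen.measurableSet]
        refine lintegral_congr fun t => ?_
        by_cases ht : t ∈ (I : Set ℝ)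
        · rw [indicator_of_mem ht, ← lintegral_indicator
            (J.isOpen.measurableSet.prod J.isOpen.measurableSet)]
          refine lintegral_congr fun p => ?_
          simp only [G, A, indicator, mem_prod, ht, true_and]
        · rw [indicator_of_notMem ht]
          simp [G, A, ht]

/-- Choice of the mollification scales: for a compactly supported `u ∈ L³` of finite energy near
`K`, the averaged increments of `u` over a suitable box are small, the cubic ones even relative
to the spatial scale. -/
theorem exists_box_lintegral_le {u : ℝ × ℝ → ℝ} (hu : Measurable u) (h1 : MemLp u 1)
    (h2 : MemLp u 2) (h3 : MemLp u 3) {K : Set (ℝ × ℝ)} {r : ℝ} (hr : 0 < r)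
    (hen : ∫⁻ y in Icc (-r) r, (∫⁻ z in K, ‖u (z - (0, y)) - u z‖ₑ ^ 3) / ‖y‖ₑ ^ 2 ≠ ⊤)
    {κ : ℝ} (hκ : 0 < κ) :
    ∃ δ ε : ℝ, 0 < δ ∧ 0 < ε ∧ δ ≤ r ∧ ε ≤ r ∧
      (∫⁻ w in box δ ε, ∫⁻ z in K, ‖u (z - w) - u z‖ₑ ≤ ENNReal.ofReal (4 * κ * (δ * ε))) ∧
      (∫⁻ w in box δ ε, ∫⁻ z in K, ‖u (z - w) - u z‖ₑ ^ 2 ≤ ENNReal.ofReal (4 * κ * (δ * ε))) ∧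
      (∫⁻ w in box δ ε, ∫⁻ z in K, ‖u (z - w) - u z‖ₑ ^ 3
        ≤ ENNReal.ofReal (24 * κ * (δ * ε ^ 2))) := by
  have hκ' : 0 < ENNReal.ofReal κ := ENNReal.ofReal_pos.2 hκ
  have t1 := tendsto_lintegral_translate_sub 1 le_rfl (by simpa using h1)
  have t2 := tendsto_lintegral_translate_sub 2 (by norm_num) (by simpa using h2)
  have t3 := tendsto_lintegral_translate_sub 3 (by norm_num) (by simpa using h3)
  obtain ⟨r₁, hr₁, H1⟩ := Metric.eventually_nhds_iff_ball.1
    (t1.eventually (Iio_mem_nhds hκ'))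
  obtain ⟨r₂, hr₂, H2⟩ := Metric.eventually_nhds_iff_ball.1
    (t2.eventually (Iio_mem_nhds hκ'))
  set N : ℝ → ℝ≥0∞ := fun y => ∫⁻ z in K, ‖u (z - (0, y)) - u z‖ₑ ^ 3 with hN
  have hNm : Measurable N := by
    have : Measurable fun p : ℝ × (ℝ × ℝ) => ‖u (p.2 - (0, p.1)) - u p.2‖ₑ ^ 3 :=
      ((hu.comp (by fun_prop)).sub (hu.comp (by fun_prop))).enorm.pow_const 3
    exact this.lintegral_prod_right'
  -- Absolute continuity of the finite integral in `hen`; this is the only place where smallness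
  -- relative to the spatial scale is gained.
  have hsmall : ∃ r₃ > 0, r₃ ≤ r ∧ ∀ ε, 0 < ε → ε ≤ r₃ →
      ∫⁻ y in Icc (-ε) ε, N y / ‖y‖ₑ ^ 2 ≤ ENNReal.ofReal κ := by
    have hvol : Tendsto (fun ε : ℝ => (volume.restrict (Icc (-r) r)) (Icc (-ε) ε)) (𝓝[>] 0)
        (𝓝 0) := by
      have : Tendsto (fun ε : ℝ => volume (Icc (-ε) ε)) (𝓝[>] 0) (𝓝 0) := by
        simp only [Real.volume_Icc]
        have : Tendsto (fun ε : ℝ => ENNReal.ofReal (ε - -ε)) (𝓝 0)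
            (𝓝 (ENNReal.ofReal (0 - -0))) :=
          (ENNReal.continuous_ofReal.comp (by fun_prop)).tendsto 0
        simp only [neg_zero, sub_zero, ENNReal.ofReal_zero] at this
        exact this.mono_left nhdsWithin_le_nhds
      exact tendsto_of_tendsto_of_tendsto_of_le_of_le tendsto_const_nhds this
        (fun _ => zero_le) (fun ε => Measure.restrict_apply_le _ _)
    have := tendsto_setLIntegral_zero hen hvol
    have hev := (this.eventually (Iio_mem_nhds hκ')).and (Ioc_mem_nhdsGT hr)
    obtain ⟨r₃, hr₃, hr₃'⟩ := hev.exists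
    refine ⟨r₃, hr₃'.1, hr₃'.2, fun ε hε hεr => ?_⟩
    rw [Measure.restrict_restrict measurableSet_Icc, inter_eq_left.2
      (Icc_subset_Icc (neg_le_neg hr₃'.2) hr₃'.2)] at hr₃
    exact (lintegral_mono_set (Icc_subset_Icc (neg_le_neg hεr) hεr)).trans hr₃.le
  obtain ⟨r₃, hr₃, hr₃r, H3⟩ := hsmall
  set ε := min (min (r₁ / 2) (r₂ / 2)) r₃ with hε
  have hε0 : 0 < ε := by positivity
  have hε1 : ε < r₁ := by
    have : ε ≤ r₁ / 2 := (min_le_left _ _).trans (min_le_left _ _)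
    linarith
  have hε2 : ε < r₂ := by
    have : ε ≤ r₂ / 2 := (min_le_left _ _).trans (min_le_right _ _)
    linarith
  have hε3 : ε ≤ r₃ := min_le_right _ _
  -- Continuity of translations in `L³` has no rate, so δ is fixed only after ε: time increments by
  -- less than `r₄` then have cubic size below κε.
  obtain ⟨r₄, hr₄, H4⟩ := Metric.eventually_nhds_iff_ball.1
    (t3.eventually (Iio_mem_nhds (ENNReal.ofReal_pos.2 (mul_pos hκ hε0))))
  set δ := min (r₄ / 2) ε with hδ
  have hδ0 : 0 < δ := by positivity
  have hδε : δ ≤ ε := min_le_right _ _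
  have hδ4 : δ < r₄ := by
    have : δ ≤ r₄ / 2 := min_le_left _ _
    linarith
  have hBball : ∀ w ∈ box δ ε, ‖w‖ ≤ ε := fun w hw =>
    mem_closedBall_zero_iff.1 (box_subset_closedBall hδε le_rfl hw)
  have hvolB := volume_box (ε := ε) hδ0.le
  have hconst : ∀ {F : ℝ × ℝ → ℝ≥0∞} {b : ℝ}, 0 ≤ b → (∀ w ∈ box δ ε, F w ≤ ENNReal.ofReal b) →
      ∫⁻ w in box δ ε, F w ≤ ENNReal.ofReal (4 * b * (δ * ε)) := by
    intro F b hb hF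
    calc ∫⁻ w in box δ ε, F w ≤ ∫⁻ w in box δ ε, ENNReal.ofReal b :=
          setLIntegral_mono' (measurableSet_box δ ε) hF
      _ = ENNReal.ofReal (4 * b * (δ * ε)) := by
          rw [setLIntegral_const, hvolB, ← ENNReal.ofReal_mul hb]
          congr 1; ring
  refine ⟨δ, ε, hδ0, hε0, hδε.trans (hε3.trans hr₃r), hε3.trans hr₃r, ?_, ?_, ?_⟩
  · refine hconst hκ.le fun w hw => ?_
    have := H1 w (by rw [mem_ball_zero_iff]; exact (hBball w hw).trans_lt hε1)
    simp only [pow_one] at this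
    exact (setLIntegral_le_lintegral _ _).trans this.le
  · refine hconst hκ.le fun w hw => ?_
    have := H2 w (by rw [mem_ball_zero_iff]; exact (hBball w hw).trans_lt hε2)
    exact (setLIntegral_le_lintegral _ _).trans (le_of_lt this)
  -- The increment is split into a pure time step and a pure space step; the factor 4 is the
  -- convexity constant of the cube.
  · have hpt : ∀ w ∈ box δ ε, ∫⁻ z in K, ‖u (z - w) - u z‖ₑ ^ 3
        ≤ ENNReal.ofReal (4 * (κ * ε)) + 4 * N w.2 := by
      intro w hw
      have hw1 : ((w.1, 0) : ℝ × ℝ) ∈ Metric.ball (0 : ℝ × ℝ) r₄ := by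
        rw [mem_ball_zero_iff, Prod.norm_def]
        simp only [norm_zero, Real.norm_eq_abs]
        exact max_lt ((abs_le.2 hw.1).trans_lt hδ4) hr₄
      have hm := H4 _ hw1
      have hcube : ∀ a b : ℝ, ‖a + b‖ₑ ^ 3 ≤ 4 * ‖a‖ₑ ^ 3 + 4 * ‖b‖ₑ ^ 3 := by
        intro a b
        have hab : |a + b| ^ 3 ≤ 4 * |a| ^ 3 + 4 * |b| ^ 3 := by
          have h1 : |a + b| ^ 3 ≤ (|a| + |b|) ^ 3 := by gcongr; exact abs_add_le a b
          nlinarith [mul_nonneg (add_nonneg (abs_nonneg a) (abs_nonneg b))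
            (sq_nonneg (|a| - |b|))]
        have e4 : (4 : ℝ≥0∞) = ENNReal.ofReal 4 := by simp
        rw [Real.enorm_eq_ofReal_abs, Real.enorm_eq_ofReal_abs, Real.enorm_eq_ofReal_abs,
          ← ENNReal.ofReal_pow (abs_nonneg _), ← ENNReal.ofReal_pow (abs_nonneg _),
          ← ENNReal.ofReal_pow (abs_nonneg _), e4, ← ENNReal.ofReal_mul (by norm_num),
          ← ENNReal.ofReal_mul (by norm_num), ← ENNReal.ofReal_add (by positivity) (by positivity)]
        exact ENNReal.ofReal_le_ofReal hab
      calc ∫⁻ z in K, ‖u (z - w) - u z‖ₑ ^ 3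
          ≤ ∫⁻ z in K, (4 * ‖u (z - w) - u (z - (0, w.2))‖ₑ ^ 3
              + 4 * ‖u (z - (0, w.2)) - u z‖ₑ ^ 3) := by
            refine lintegral_mono fun z => ?_
            refine le_of_eq_of_le ?_ (hcube _ _)
            simp
        _ = 4 * (∫⁻ z in K, ‖u (z - w) - u (z - (0, w.2))‖ₑ ^ 3) + 4 * N w.2 := by
            rw [lintegral_add_left, lintegral_const_mul' _ _ (by simp),
              lintegral_const_mul' _ _ (by simp)]
            exact (((hu.comp (by fun_prop)).sub (hu.comp (by fun_prop))).enorm.pow_const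
              3).const_mul 4
        _ ≤ 4 * ENNReal.ofReal (κ * ε) + 4 * N w.2 := by
            gcongr
            calc ∫⁻ z in K, ‖u (z - w) - u (z - (0, w.2))‖ₑ ^ 3
                ≤ ∫⁻ z, ‖u (z - w) - u (z - (0, w.2))‖ₑ ^ 3 := setLIntegral_le_lintegral _ _
              _ = ∫⁻ z, ‖u (z - (0, w.2) - (w.1, 0)) - u (z - (0, w.2))‖ₑ ^ 3 := by
                  refine lintegral_congr fun z => ?_
                  congr 4
                  rw [sub_sub]
                  congr 1
                  ext <;> simp
              _ = ∫⁻ z, ‖u (z - (w.1, 0)) - u z‖ₑ ^ 3 :=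
                  lintegral_sub_right_eq_self (fun z => ‖u (z - (w.1, 0)) - u z‖ₑ ^ 3) _
              _ ≤ ENNReal.ofReal (κ * ε) := le_of_lt hm
        _ = ENNReal.ofReal (4 * (κ * ε)) + 4 * N w.2 := by
            rw [ENNReal.ofReal_mul (p := 4) (by norm_num)]; simp
    -- On `|y| ≤ ε` the weight `|y|⁻²` is at least `ε⁻²`, which yields the gain of `ε²`.
    have hNint : ∫⁻ y in Icc (-ε) ε, N y ≤ ENNReal.ofReal (ε ^ 2 * κ) := by
      calc ∫⁻ y in Icc (-ε) ε, N y
          ≤ ∫⁻ y in Icc (-ε) ε, ENNReal.ofReal (ε ^ 2) * (N y / ‖y‖ₑ ^ 2) := by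
            refine setLIntegral_mono' measurableSet_Icc fun y hy => ?_
            rcases eq_or_ne y 0 with rfl | hy0
            · have h0 : ∀ z : ℝ × ℝ, z - ((0 : ℝ), (0 : ℝ)) = z := fun z => by
                ext <;> simp
              simp [N, h0]
            have hy2 : ‖y‖ₑ ^ 2 ≠ 0 := by simpa using hy0
            calc N y = ‖y‖ₑ ^ 2 * (N y / ‖y‖ₑ ^ 2) :=
                  (ENNReal.mul_div_cancel hy2 (by simp)).symm
              _ ≤ _ := by
                  gcongr
                  rw [Real.enorm_eq_ofReal_abs, ← ENNReal.ofReal_pow (abs_nonneg _)]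
                  refine ENNReal.ofReal_le_ofReal ?_
                  have := abs_le.2 hy
                  gcongr
        _ = ENNReal.ofReal (ε ^ 2) * ∫⁻ y in Icc (-ε) ε, N y / ‖y‖ₑ ^ 2 :=
            lintegral_const_mul' _ _ (by simp)
        _ ≤ ENNReal.ofReal (ε ^ 2) * ENNReal.ofReal κ := by gcongr; exact H3 ε hε0 hε3
        _ = ENNReal.ofReal (ε ^ 2 * κ) := (ENNReal.ofReal_mul (by positivity)).symm
    have hNbox : ∫⁻ w in box δ ε, N w.2 ≤ ENNReal.ofReal (2 * δ * (ε ^ 2 * κ)) := by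
      rw [box, Measure.volume_eq_prod, ← Measure.prod_restrict,
        lintegral_prod (fun w : ℝ × ℝ => N w.2) (hNm.comp measurable_snd).aemeasurable]
      simp only [lintegral_const, Measure.restrict_apply MeasurableSet.univ, univ_inter,
        Real.volume_Icc]
      rw [ENNReal.ofReal_mul (by positivity), mul_comm]
      gcongr
      linarith
    calc ∫⁻ w in box δ ε, ∫⁻ z in K, ‖u (z - w) - u z‖ₑ ^ 3
        ≤ ∫⁻ w in box δ ε, (ENNReal.ofReal (4 * (κ * ε)) + 4 * N w.2) :=
          setLIntegral_mono' (measurableSet_box δ ε) hpt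
      _ = (∫⁻ w in box δ ε, ENNReal.ofReal (4 * (κ * ε))) + 4 * ∫⁻ w in box δ ε, N w.2 := by
          rw [lintegral_add_left measurable_const, lintegral_const_mul' _ _ (by simp)]
      _ ≤ ENNReal.ofReal (4 * (4 * (κ * ε)) * (δ * ε))
            + 4 * ENNReal.ofReal (2 * δ * (ε ^ 2 * κ)) := by
          gcongr
          exact hconst (by positivity) fun w _ => le_rfl
      -- The time step contributes 16 and the space step 8.
      _ = ENNReal.ofReal (24 * κ * (δ * ε ^ 2)) := by
          rw [show (4 : ℝ≥0∞) = ENNReal.ofReal 4 by simp, ← ENNReal.ofReal_mul (by norm_num),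
            ← ENNReal.ofReal_add (by positivity) (by positivity)]
          congr 1; ring

end Smallness

/-! ### Exact balance laws for entropies with smooth compactly supported derivative. -/

section SmoothEntropies

open Filter Topology
open scoped ContDiff

theorem fderiv_testFunction_eq_zero {Ω : Opens (ℝ × ℝ)} (φ : 𝓓(Ω, ℝ)) {z : ℝ × ℝ}
    (hz : z ∉ tsupport φ) : fderiv ℝ φ z = 0 :=
  image_eq_zero_of_notMem_tsupport fun h => hz (tsupport_fderiv_subset ℝ h)

/-- The action of a test function only sees the values on its support. -/
theorem weakPairing_eq_integral {Ω : Opens (ℝ × ℝ)} {a b a' b' : ℝ × ℝ → ℝ} (φ : 𝓓(Ω, ℝ))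
    (ha : ∀ z ∈ tsupport φ, a z = a' z) (hb : ∀ z ∈ tsupport φ, b z = b' z) :
    weakPairing Ω a b φ
      = ∫ z, (a' z * fderiv ℝ φ z (1, 0) + b' z * fderiv ℝ φ z (0, 1)) := by
  rw [weakPairing, setIntegral_eq_integral_of_forall_compl_eq_zero]
  · refine integral_congr_ae (Eventually.of_forall fun z => ?_)
    by_cases hz : z ∈ tsupport φ
    · simp only [ha z hz, hb z hz]
    · simp [fderiv_testFunction_eq_zero φ hz]
  · intro z hz
    have : z ∉ tsupport φ := fun h => hz (φ.tsupport_subset h)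
    simp [fderiv_testFunction_eq_zero φ this]

theorem memLp_indicator_of_isCompact {Ω K : Set (ℝ × ℝ)} {v : ℝ × ℝ → ℝ}
    (hv4 : MemLp v 4 (volume.restrict Ω)) (hK : IsCompact K) (hKΩ : K ⊆ Ω) {p : ℝ≥0∞}
    (hp : p ≤ 4) : MemLp (K.indicator v) p := by
  have : IsFiniteMeasure (volume.restrict K) := ⟨by simpa using hK.measure_lt_top⟩
  rw [memLp_indicator_iff_restrict hK.measurableSet]
  exact (hv4.mono_measure (Measure.restrict_mono hKΩ le_rfl)).mono_exponent hp

/-- Mollifications of a weak solution satisfy the mollified equation. -/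
theorem fderiv_mollify_add_eq_zero {Ω : Opens (ℝ × ℝ)} {v u k : ℝ × ℝ → ℝ}
    (hb : IsBurgersSolution Ω v) (hk : ContDiff ℝ ∞ k) (hkc : HasCompactSupport k)
    (hu : LocallyIntegrable u) (hu2 : LocallyIntegrable (fun z => u z ^ 2 / 2)) {z : ℝ × ℝ}
    (hz : ∀ w ∈ tsupport k, z - w ∈ Ω ∧ u (z - w) = v (z - w)) :
    fderiv ℝ (mollify k u) z (1, 0) + fderiv ℝ (mollify k fun z => u z ^ 2 / 2) z (0, 1) = 0 := by
  have hcl : IsClosed {w | z - w ∈ tsupport k} :=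
    (isClosed_tsupport k).preimage (by fun_prop)
  have hts : tsupport (fun w => k (z - w)) ⊆ {w | z - w ∈ tsupport k} :=
    closure_minimal (fun w hw => subset_tsupport k hw) hcl
  -- The mollified equation at `z` is the weak equation tested against the reflected kernel centred
  -- at `z`; reflection flips the sign of both derivatives.
  let ψ : 𝓓(Ω, ℝ) :=
    { toFun := fun w => k (z - w)
      contDiff' := hk.comp (by fun_prop)
      hasCompactSupport' := hkc.comp_homeomorph (Homeomorph.subLeft z)
      tsupport_subset' := by
        intro w hw
        have := (hz _ (hts hw)).1
        simpa using this }
  have hψ : ∀ w e, fderiv ℝ ψ w e = - fderiv ℝ k (z - w) e := by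
    intro w e
    have h1 : HasFDerivAt k (fderiv ℝ k (z - w)) (z - w) :=
      (hk.differentiable (by simp)).differentiableAt.hasFDerivAt
    have h2 : HasFDerivAt (fun w : ℝ × ℝ => z - w) (-ContinuousLinearMap.id ℝ (ℝ × ℝ)) w :=
      (hasFDerivAt_id w).const_sub z
    have h3 : HasFDerivAt ψ _ w := h1.comp w h2
    rw [h3.fderiv]
    simp
  have huv : ∀ w ∈ tsupport ψ, v w = u w := by
    intro w hw
    have := (hz _ (hts hw)).2
    simpa using this.symm
  have h0 := hb.eq_zero ψ
  rw [weakPairing_eq_integral (a' := u) (b' := fun z => u z ^ 2 / 2) ψ huv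
    (fun w hw => by rw [huv w hw])] at h0
  have hi : ∀ (f : ℝ × ℝ → ℝ) (e : ℝ × ℝ), LocallyIntegrable f →
      Integrable fun w => f w * fderiv ℝ ψ w e := by
    intro f e hf
    have hcont : Continuous fun w => fderiv ℝ ψ w e :=
      (ψ.contDiff.continuous_fderiv (by simp)).clm_apply continuous_const
    have := hf.integrable_smul_left_of_hasCompactSupport hcont
      (ψ.hasCompactSupport.fderiv_apply (𝕜 := ℝ) e)
    refine this.congr (Eventually.of_forall fun w => ?_)
    simp [mul_comm]
  rw [integral_add (hi u _ hu) (hi (fun z => u z ^ 2 / 2) _ hu2)] at h0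
  simp only [hψ, mul_neg, integral_neg] at h0
  rw [fderiv_mollify hk hkc hu, fderiv_mollify hk hkc hu2, mollify, mollify]
  linarith

/-- Bounds for the mollification error, the commutator and its product with the spatial derivative
in terms of averaged increments. -/
theorem lintegral_mollify_error_le {u k : ℝ × ℝ → ℝ} {K : Set (ℝ × ℝ)} {C δ ε κ : ℝ}
    (hum : Measurable u) (hul : LocallyIntegrable u)
    (husq : LocallyIntegrable (fun z => u z ^ 2)) (hC : 0 < C) (hδ : 0 < δ) (hε : 0 < ε)
    (hκ : 0 < κ) (hks : ContDiff ℝ ∞ k) (hkc : HasCompactSupport k) (hk0 : ∀ w, 0 ≤ k w)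
    (hk1 : ∫ w, k w = 1)
    (hkB : ∀ w, ‖k w‖ₑ ≤ (box δ ε).indicator (fun _ => ENNReal.ofReal (C / (δ * ε))) w)
    (hkB' : ∀ w, ‖fderiv ℝ k w (0, 1)‖ₑ
      ≤ (box δ ε).indicator (fun _ => ENNReal.ofReal (C / (δ * ε ^ 2))) w)
    (E1 : ∫⁻ w in box δ ε, ∫⁻ z in K, ‖u (z - w) - u z‖ₑ ≤ ENNReal.ofReal (4 * κ * (δ * ε)))
    (E2 : ∫⁻ w in box δ ε, ∫⁻ z in K, ‖u (z - w) - u z‖ₑ ^ 2 ≤ ENNReal.ofReal (4 * κ * (δ * ε)))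
    (E3 : ∫⁻ w in box δ ε, ∫⁻ z in K, ‖u (z - w) - u z‖ₑ ^ 3
      ≤ ENNReal.ofReal (24 * κ * (δ * ε ^ 2))) :
    (∫⁻ z in K, ‖mollify k u z - u z‖ₑ ≤ ENNReal.ofReal (4 * C * κ)) ∧
    (∫⁻ z in K, ‖mollify k (fun z => u z ^ 2 / 2) z - mollify k u z ^ 2 / 2‖ₑ
      ≤ ENNReal.ofReal (4 * C * κ)) ∧
    (∫⁻ z in K, ‖mollify k (fun z => u z ^ 2 / 2) z - mollify k u z ^ 2 / 2‖ₑ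
      * ‖fderiv ℝ (mollify k u) z (0, 1)‖ₑ ≤ ENNReal.ofReal (192 * C ^ 2 * κ)) := by
  set B := box δ ε
  have hB : MeasurableSet B := measurableSet_box δ ε
  set V := mollify k u with hVdef
  set S := mollify k (fun z => u z ^ 2 / 2) with hSdef
  set c := ENNReal.ofReal (C / (δ * ε))
  set c' := ENNReal.ofReal (C / (δ * ε ^ 2))
  have hct : c ≠ ⊤ := ENNReal.ofReal_ne_top
  have hct' : c' ≠ ⊤ := ENNReal.ofReal_ne_top
  have ham : Measurable fun p : (ℝ × ℝ) × (ℝ × ℝ) => ‖u (p.1 - p.2) - u p.1‖ₑ :=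
    ((hum.comp (by fun_prop)).sub (hum.comp (by fun_prop))).enorm
  have e1 : ∀ z, ‖V z - u z‖ₑ ≤ c * ∫⁻ w in B, ‖u (z - w) - u z‖ₑ := fun z =>
    enorm_mollify_sub_le hks.continuous hkc hul hk1 hB hkB hct z
  have e2 : ∀ z, ‖S z - V z ^ 2 / 2‖ₑ ≤ c * ∫⁻ w in B, ‖u (z - w) - u z‖ₑ ^ 2 := by
    intro z
    refine le_trans ?_
      (enorm_mollify_sq_sub_sq_le hks.continuous hkc hul husq hk1 hk0 hB hkB hct z)
    have : S z - V z ^ 2 / 2 = (mollify k (fun z => u z ^ 2) z - mollify k u z ^ 2) / 2 := by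
      have : S z = mollify k (fun z => u z ^ 2) z / 2 := by
        rw [hSdef, mollify, mollify, ← integral_div]
        congr 1; ext w; ring
      rw [this, hVdef]; ring
    rw [this, Real.enorm_eq_ofReal_abs, Real.enorm_eq_ofReal_abs, abs_div]
    refine ENNReal.ofReal_le_ofReal ?_
    rw [abs_two]
    linarith [abs_nonneg (mollify k (fun z => u z ^ 2) z - mollify k u z ^ 2)]
  have e3 : ∀ z, ‖fderiv ℝ V z (0, 1)‖ₑ ≤ c' * ∫⁻ w in B, ‖u (z - w) - u z‖ₑ := by
    intro z
    rw [hVdef, fderiv_mollify hks hkc hul]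
    exact enorm_mollify_le_of_integral_eq_zero
      ((hks.continuous_fderiv (by simp)).clm_apply continuous_const)
      (hkc.fderiv_apply (𝕜 := ℝ) _) hul
      (integral_fderiv_apply_eq_zero (hks.of_le (by simp)) hkc _) hB hkB' hct' z
  -- The powers of the scales cancel here: `c c' · 2|B|` equals `8C² / (δ ε²)`, and the cubic
  -- increments are at most `24 κ δ ε²`, whence the constant 192.
  have e4 : ∀ z, ‖S z - V z ^ 2 / 2‖ₑ * ‖fderiv ℝ V z (0, 1)‖ₑ
      ≤ (c * c' * (2 * volume B)) * ∫⁻ w in B, ‖u (z - w) - u z‖ₑ ^ 3 := by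
    intro z
    have haz : Measurable fun w => ‖u (z - w) - u z‖ₑ :=
      ((hum.comp (measurable_const.sub measurable_id)).sub measurable_const).enorm
    calc ‖S z - V z ^ 2 / 2‖ₑ * ‖fderiv ℝ V z (0, 1)‖ₑ
        ≤ (c * ∫⁻ w in B, ‖u (z - w) - u z‖ₑ ^ 2) * (c' * ∫⁻ w in B, ‖u (z - w) - u z‖ₑ) :=
          mul_le_mul' (e2 z) (e3 z)
      _ = c * c' * ((∫⁻ w in B, ‖u (z - w) - u z‖ₑ) * ∫⁻ w in B, ‖u (z - w) - u z‖ₑ ^ 2) := by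
          ring
      _ ≤ c * c' * (2 * (volume.restrict B) univ * ∫⁻ w in B, ‖u (z - w) - u z‖ₑ ^ 3) := by
          exact mul_le_mul_right (lintegral_mul_lintegral_sq_le _ haz) _
      _ = _ := by rw [Measure.restrict_apply_univ]; ring
  have hswap : ∀ n : ℕ, ∫⁻ z in K, ∫⁻ w in B, ‖u (z - w) - u z‖ₑ ^ n
      = ∫⁻ w in B, ∫⁻ z in K, ‖u (z - w) - u z‖ₑ ^ n := fun n =>
    lintegral_lintegral_swap (ham.pow_const n).aemeasurable
  have hvB : volume B = ENNReal.ofReal (4 * (δ * ε)) := volume_box hδ.le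
  have I1 : ∫⁻ z in K, ‖V z - u z‖ₑ ≤ ENNReal.ofReal (4 * C * κ) := by
    calc ∫⁻ z in K, ‖V z - u z‖ₑ ≤ ∫⁻ z in K, c * ∫⁻ w in B, ‖u (z - w) - u z‖ₑ :=
          lintegral_mono e1
      _ = c * ∫⁻ w in B, ∫⁻ z in K, ‖u (z - w) - u z‖ₑ := by
          rw [lintegral_const_mul' _ _ hct]
          have := hswap 1
          simp only [pow_one] at this
          rw [this]
      _ ≤ c * ENNReal.ofReal (4 * κ * (δ * ε)) := by gcongr
      _ = ENNReal.ofReal (4 * C * κ) := by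
          rw [← ENNReal.ofReal_mul (by positivity)]
          congr 1; field_simp
  have I2 : ∫⁻ z in K, ‖S z - V z ^ 2 / 2‖ₑ ≤ ENNReal.ofReal (4 * C * κ) := by
    calc ∫⁻ z in K, ‖S z - V z ^ 2 / 2‖ₑ
        ≤ ∫⁻ z in K, c * ∫⁻ w in B, ‖u (z - w) - u z‖ₑ ^ 2 := lintegral_mono e2
      _ = c * ∫⁻ w in B, ∫⁻ z in K, ‖u (z - w) - u z‖ₑ ^ 2 := by
          rw [lintegral_const_mul' _ _ hct, hswap 2]
      _ ≤ c * ENNReal.ofReal (4 * κ * (δ * ε)) := by gcongr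
      _ = ENNReal.ofReal (4 * C * κ) := by
          rw [← ENNReal.ofReal_mul (by positivity)]
          congr 1; field_simp
  have I3 : ∫⁻ z in K, ‖S z - V z ^ 2 / 2‖ₑ * ‖fderiv ℝ V z (0, 1)‖ₑ
      ≤ ENNReal.ofReal (192 * C ^ 2 * κ) := by
    have hc3 : c * c' * (2 * volume B) ≠ ⊤ := by
      rw [hvB]
      exact ENNReal.mul_ne_top (ENNReal.mul_ne_top hct hct')
        (ENNReal.mul_ne_top (by simp) ENNReal.ofReal_ne_top)
    calc ∫⁻ z in K, ‖S z - V z ^ 2 / 2‖ₑ * ‖fderiv ℝ V z (0, 1)‖ₑ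
        ≤ ∫⁻ z in K, (c * c' * (2 * volume B)) * ∫⁻ w in B, ‖u (z - w) - u z‖ₑ ^ 3 :=
          lintegral_mono e4
      _ = (c * c' * (2 * volume B)) * ∫⁻ w in B, ∫⁻ z in K, ‖u (z - w) - u z‖ₑ ^ 3 := by
          rw [lintegral_const_mul' _ _ hc3, hswap 3]
      _ ≤ (c * c' * (2 * volume B)) * ENNReal.ofReal (24 * κ * (δ * ε ^ 2)) := by gcongr
      _ = ENNReal.ofReal (192 * C ^ 2 * κ) := by
          rw [hvB, show (2 : ℝ≥0∞) = ENNReal.ofReal 2 by simp,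
            ← ENNReal.ofReal_mul (by positivity), ← ENNReal.ofReal_mul (by positivity),
            ← ENNReal.ofReal_mul (by positivity), ← ENNReal.ofReal_mul (by positivity)]
          congr 1; field_simp; norm_num
  exact ⟨I1, I2, I3⟩

/-- Pointwise comparison of the entropy integrand at `u` with that of the exact identity at `V`,
where `D` stands for the commutator and `Vs` for `V_s`. Only the term `|D| |Vs|` needs the
fractional regularity. -/
theorem abs_entropy_error_le {P u V η₁ η₂ q₁ q₂ φt φs φ D Vs h h' : ℝ} (hP : 0 ≤ P)
    (hη : |η₁ - η₂| ≤ P * |u - V|) (hq : |q₁ - q₂| ≤ P * |u - V|) (h1 : |φt| ≤ P)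
    (h2 : |φs| ≤ P) (h3 : |φ| ≤ P) (h4 : |h| ≤ P) (h5 : |h'| ≤ P) :
    |η₁ * φt + q₁ * φs - (η₂ * φt + q₂ * φs + D * (h' * Vs * φ + h * φs))|
      ≤ 2 * P ^ 2 * (|V - u| + (|D| + |D| * |Vs|)) := by
  have b1 : |(η₁ - η₂) * φt| ≤ P ^ 2 * |V - u| := by
    rw [abs_mul, abs_sub_comm V]
    calc _ ≤ (P * |u - V|) * P := by
           gcongr
      _ = _ := by ring
  have b2 : |(q₁ - q₂) * φs| ≤ P ^ 2 * |V - u| := by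
    rw [abs_mul, abs_sub_comm V]
    calc _ ≤ (P * |u - V|) * P := by
           gcongr
      _ = _ := by ring
  have b3 : |D * (h' * Vs * φ)| ≤ P ^ 2 * (|D| * |Vs|) := by
    rw [abs_mul, abs_mul, abs_mul]
    calc _ ≤ |D| * (P * |Vs| * P) := by
           gcongr
      _ = _ := by ring
  have b4 : |D * (h * φs)| ≤ P ^ 2 * |D| := by
    rw [abs_mul, abs_mul]
    calc _ ≤ |D| * (P * P) := by
           gcongr
      _ = _ := by ring
  have hsplit : η₁ * φt + q₁ * φs - (η₂ * φt + q₂ * φs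
      + D * (h' * Vs * φ + h * φs))
      = (η₁ - η₂) * φt + (q₁ - q₂) * φs
        - (D * (h' * Vs * φ) + D * (h * φs)) := by ring
  rw [hsplit]
  have t1 := abs_sub ((η₁ - η₂) * φt + (q₁ - q₂) * φs)
    (D * (h' * Vs * φ) + D * (h * φs))
  have t2 := abs_add_le ((η₁ - η₂) * φt) ((q₁ - q₂) * φs)
  have t3 := abs_add_le (D * (h' * Vs * φ)) (D * (h * φs))
  have p1 : 0 ≤ P ^ 2 * |D| := by positivity
  have p2 : 0 ≤ P ^ 2 * (|D| * |Vs|) := by positivity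
  linarith

/-- A finite-energy solution satisfies every balance law with smooth compactly supported `η'`. -/
theorem weakPairing_eq_zero_of_contDiff {I J : Opens ℝ} {v : ℝ × ℝ → ℝ} (hv : Measurable v)
    (hv4 : MemLp v 4 (volume.restrict (rect I J : Set (ℝ × ℝ))))
    (hb : IsBurgersSolution (rect I J) v) (hreg : timeSpaceEnergy I J v < ⊤) {η q h : ℝ → ℝ}
    (hh : ContDiff ℝ ∞ h) (hhc : HasCompactSupport h) (hη : ∀ x, HasDerivAt η (h x) x)
    (hq : ∀ x, HasDerivAt q (x * h x) x) (φ : 𝓓(rect I J, ℝ)) :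
    weakPairing (rect I J) (fun z => η (v z)) (fun z => q (v z)) φ = 0 := by
  set K := tsupport φ with hKdef
  have hK : IsCompact K := φ.hasCompactSupport
  obtain ⟨r, hr, hKr⟩ := hK.exists_cthickening_subset_open (rect I J).isOpen φ.tsupport_subset
  set K₂ := Metric.cthickening r K with hK₂def
  have hK₂ : IsCompact K₂ := hK.cthickening
  set u := K₂.indicator v with hudef
  have hum : Measurable u := hv.indicator hK₂.measurableSet
  have huv : ∀ z ∈ K₂, u z = v z := fun z hz => indicator_of_mem hz v
  have hKK₂ : K ⊆ K₂ := Metric.self_subset_cthickening K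
  have hmem : ∀ z ∈ K, ∀ w : ℝ × ℝ, ‖w‖ ≤ r → z - w ∈ K₂ := by
    intro z hz w hw
    refine Metric.mem_cthickening_of_dist_le _ z _ _ hz ?_
    rw [dist_eq_norm]; simpa using hw
  have hu1 : MemLp u 1 := memLp_indicator_of_isCompact hv4 hK₂ hKr (by norm_num)
  have hu2 : MemLp u 2 := memLp_indicator_of_isCompact hv4 hK₂ hKr (by norm_num)
  have hu3 : MemLp u 3 := memLp_indicator_of_isCompact hv4 hK₂ hKr (by norm_num)
  have hul : LocallyIntegrable u := (memLp_one_iff_integrable.1 hu1).locallyIntegrable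
  have husq : LocallyIntegrable (fun z => u z ^ 2) := hu2.integrable_sq.locallyIntegrable
  have husq' : LocallyIntegrable (fun z => u z ^ 2 / 2) :=
    (hu2.integrable_sq.div_const 2).locallyIntegrable
  have hen := lintegral_spatial_increment_le (I := I) (J := J) (u := u) hv hK.measurableSet
    (r := r) (by
      intro z hz y hy
      have : z - (0, y) ∈ K₂ := hmem z hz _ (by
        rw [Prod.norm_def]
        simp only [norm_zero, Real.norm_eq_abs]
        exact max_le hr.le (abs_le.2 hy))
      exact ⟨hKr this, huv _ this⟩)
  rw [weakPairing_eq_integral (a' := fun z => η (u z)) (b' := fun z => q (u z)) φ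
    (fun z hz => by rw [huv z (hKK₂ hz)]) (fun z hz => by rw [huv z (hKK₂ hz)])]
  -- If the integrand were not integrable, its Bochner integral would be zero by convention.
  by_cases hLHS : Integrable
    (fun z => η (u z) * fderiv ℝ φ z (1, 0) + q (u z) * fderiv ℝ φ z (0, 1))
  swap
  · exact integral_undef hLHS
  have hxh : Continuous fun x : ℝ => x * h x := continuous_id.mul hh.continuous
  have hφd : ∀ e, ∃ P, ∀ z, ‖fderiv ℝ φ z e‖ ≤ P := fun e =>
    ((φ.contDiff.continuous_fderiv (by simp)).clm_apply
      continuous_const).bounded_above_of_compact_support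
      (φ.hasCompactSupport.fderiv_apply (𝕜 := ℝ) e)
  obtain ⟨P₁, hP₁⟩ := hh.continuous.bounded_above_of_compact_support hhc
  obtain ⟨P₂, hP₂⟩ := (hh.continuous_deriv (by simp)).bounded_above_of_compact_support hhc.deriv
  obtain ⟨P₃, hP₃⟩ := hxh.bounded_above_of_compact_support hhc.mul_left
  obtain ⟨P₄, hP₄⟩ := φ.continuous.bounded_above_of_compact_support φ.hasCompactSupport
  obtain ⟨P₅, hP₅⟩ := hφd (1, 0)
  obtain ⟨P₆, hP₆⟩ := hφd (0, 1)
  obtain ⟨P, hP⟩ : ∃ P, P = max P₁ (max P₂ (max P₃ (max P₄ (max P₅ (max P₆ 0))))) := ⟨_, rfl⟩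
  have hP0 : 0 ≤ P := by rw [hP]; simp
  replace hP₁ : ∀ x, |h x| ≤ P := fun x => (hP₁ x).trans (by rw [hP]; simp)
  replace hP₂ : ∀ x, |deriv h x| ≤ P := fun x => (hP₂ x).trans (by rw [hP]; simp)
  replace hP₃ : ∀ x, |x * h x| ≤ P := fun x => (hP₃ x).trans (by rw [hP]; simp)
  replace hP₄ : ∀ z, |φ z| ≤ P := fun x => (hP₄ x).trans (by rw [hP]; simp)
  replace hP₅ : ∀ z, |fderiv ℝ φ z (1, 0)| ≤ P := fun x => (hP₅ x).trans (by rw [hP]; simp)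
  replace hP₆ : ∀ z, |fderiv ℝ φ z (0, 1)| ≤ P := fun x => (hP₆ x).trans (by rw [hP]; simp)
  have hηL : ∀ x y, |η x - η y| ≤ P * |x - y| := fun x y =>
    convex_univ.norm_image_sub_le_of_norm_hasDerivWithin_le
      (fun x _ => (hη x).hasDerivWithinAt) (fun x _ => hP₁ x) (mem_univ y) (mem_univ x)
  have hqL : ∀ x y, |q x - q y| ≤ P * |x - y| := fun x y =>
    convex_univ.norm_image_sub_le_of_norm_hasDerivWithin_le
      (fun x _ => (hq x).hasDerivWithinAt) (fun x _ => hP₃ x) (mem_univ y) (mem_univ x)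
  obtain ⟨C, hC, hker⟩ := exists_kernel
  set Q := ∫ z, (η (u z) * fderiv ℝ φ z (1, 0) + q (u z) * fderiv ℝ φ z (0, 1)) with hQ
  -- `Q`, `P` and `C` do not depend on κ, and κ is sent to zero at the end. The integral of the
  -- identity at `V` is zero, so it can be subtracted from `Q`.
  have key : ∀ κ : ℝ, 0 < κ → |Q| ≤ 2 * P ^ 2 * (8 * C + 192 * C ^ 2) * κ := by
    intro κ hκ
    obtain ⟨δ, ε, hδ, hε, hδr, hεr, E1, E2, E3⟩ := exists_box_lintegral_le hum hu1 hu2 hu3 hr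
      (hen.trans_lt hreg).ne hκ
    obtain ⟨k, hks, hkc, hkt, hk0, hk1, hkB, hkB'⟩ := hker δ ε hδ hε
    have hBr : ∀ w ∈ box δ ε, ‖w‖ ≤ r := fun w hw =>
      mem_closedBall_zero_iff.1 (box_subset_closedBall hδr hεr hw)
    set V := mollify k u with hVdef
    set S := mollify k (fun z => u z ^ 2 / 2) with hSdef
    obtain ⟨hYi, hY⟩ := integral_entropy_identity (V := V) (S := S)
      (contDiff_mollify hks hkc hul) (contDiff_mollify hks hkc husq') φ.contDiff
      φ.hasCompactSupport hh hη hq (fun z hz => by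
        refine fderiv_mollify_add_eq_zero hb hks hkc hul husq' fun w hw => ?_
        have := hmem z hz w (hBr w (hkt hw))
        exact ⟨hKr this, huv _ this⟩)
    obtain ⟨I1, I2, I3⟩ := lintegral_mollify_error_le hum hul husq hC hδ hε hκ hks hkc hk0 hk1
      hkB hkB' E1 E2 E3
    have hVm : Measurable V := (contDiff_mollify hks hkc hul).continuous.measurable
    have hSm : Measurable S := (contDiff_mollify hks hkc husq').continuous.measurable
    have m1 : Measurable fun z => ‖V z - u z‖ₑ := (hVm.sub hum).enorm
    have m2 : Measurable fun z => ‖S z - V z ^ 2 / 2‖ₑ :=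
      (hSm.sub ((hVm.pow_const 2).div_const 2)).enorm
    have hdiff : Q = ∫ z, ((η (u z) * fderiv ℝ φ z (1, 0) + q (u z) * fderiv ℝ φ z (0, 1))
        - (η (V z) * fderiv ℝ φ z (1, 0) + q (V z) * fderiv ℝ φ z (0, 1)
      + (S z - V z ^ 2 / 2) * (deriv h (V z) * fderiv ℝ V z (0, 1) * φ z
        + h (V z) * fderiv ℝ φ z (0, 1)))) := by
      rw [integral_sub hLHS hYi, hY, sub_zero]
    have hbound : ‖Q‖ₑ ≤ ENNReal.ofReal (2 * P ^ 2 * (8 * C + 192 * C ^ 2) * κ) := by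
      rw [hdiff]
      refine (enorm_integral_le_lintegral_enorm _).trans ?_
      calc _ ≤ ∫⁻ z, K.indicator (fun z => ENNReal.ofReal (2 * P ^ 2) * (‖V z - u z‖ₑ +
              (‖S z - V z ^ 2 / 2‖ₑ + ‖S z - V z ^ 2 / 2‖ₑ * ‖fderiv ℝ V z (0, 1)‖ₑ))) z := by
            refine lintegral_mono fun z => ?_
            by_cases hz : z ∈ K
            · rw [indicator_of_mem hz]
              simp only [Real.enorm_eq_ofReal_abs]
              rw [← ENNReal.ofReal_mul (abs_nonneg _),
                ← ENNReal.ofReal_add (abs_nonneg _) (by positivity),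
                ← ENNReal.ofReal_add (abs_nonneg _) (by positivity),
                ← ENNReal.ofReal_mul (by positivity)]
              refine ENNReal.ofReal_le_ofReal ?_
              exact abs_entropy_error_le hP0 (hηL _ _) (hqL _ _) (hP₅ z) (hP₆ z) (hP₄ z)
                (hP₁ _) (hP₂ _)
            · rw [indicator_of_notMem hz, fderiv_testFunction_eq_zero φ hz,
                image_eq_zero_of_notMem_tsupport hz]
              simp
        _ = ENNReal.ofReal (2 * P ^ 2) * ((∫⁻ z in K, ‖V z - u z‖ₑ) +
              ((∫⁻ z in K, ‖S z - V z ^ 2 / 2‖ₑ) +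
                ∫⁻ z in K, ‖S z - V z ^ 2 / 2‖ₑ * ‖fderiv ℝ V z (0, 1)‖ₑ)) := by
            rw [lintegral_indicator hK.measurableSet,
              lintegral_const_mul' _ _ ENNReal.ofReal_ne_top,
              lintegral_add_left m1, lintegral_add_left m2]
        _ ≤ ENNReal.ofReal (2 * P ^ 2) * (ENNReal.ofReal (4 * C * κ) +
              (ENNReal.ofReal (4 * C * κ) + ENNReal.ofReal (192 * C ^ 2 * κ))) := by
            gcongr
        _ = _ := by
            rw [← ENNReal.ofReal_add (by positivity) (by positivity),
              ← ENNReal.ofReal_add (by positivity) (by positivity),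
              ← ENNReal.ofReal_mul (by positivity)]
            congr 1; ring
    rw [Real.enorm_eq_ofReal_abs] at hbound
    exact (ENNReal.ofReal_le_ofReal_iff (by positivity)).1 hbound
  have hlim : Tendsto (fun κ : ℝ => 2 * P ^ 2 * (8 * C + 192 * C ^ 2) * κ) (𝓝[>] 0) (𝓝 0) := by
    have : Tendsto (fun κ : ℝ => 2 * P ^ 2 * (8 * C + 192 * C ^ 2) * κ) (𝓝 0)
        (𝓝 (2 * P ^ 2 * (8 * C + 192 * C ^ 2) * 0)) := by
      exact (continuous_const.mul continuous_id).tendsto 0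
    rw [mul_zero] at this
    exact this.mono_left nhdsWithin_le_nhds
  have : |Q| ≤ 0 := ge_of_tendsto hlim (by
    filter_upwards [self_mem_nhdsWithin] with κ hκ using key κ hκ)
  exact abs_nonpos_iff.1 this

end SmoothEntropies

/-! ### Kinetic formulation: free transport of the superlevel sets. -/

section Kinetic

open Filter Topology
open scoped ContDiff

theorem fderiv_apply_one_eq (φ : ℝ × ℝ → ℝ) (z : ℝ × ℝ) (ξ : ℝ) :
    fderiv ℝ φ z (1, ξ) = fderiv ℝ φ z (1, 0) + ξ * fderiv ℝ φ z (0, 1) := by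
  have : ((1, ξ) : ℝ × ℝ) = (1, 0) + ξ • (0, 1) := by ext <;> simp
  rw [this, map_add, map_smul, smul_eq_mul]

theorem integrable_fderiv_testFunction {Ω : Opens (ℝ × ℝ)} (φ : 𝓓(Ω, ℝ)) (e : ℝ × ℝ) :
    Integrable fun z => fderiv ℝ φ z e :=
  ((φ.contDiff.continuous_fderiv (by simp)).clm_apply
    continuous_const).integrable_of_hasCompactSupport (φ.hasCompactSupport.fderiv_apply (𝕜 := ℝ) e)

/-- The transport operator `∂_t + ξ ∂_s` tested against the superlevel set `{v > ξ}`. -/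
noncomputable def superlevelPairing (v φ : ℝ × ℝ → ℝ) (ξ : ℝ) : ℝ :=
  ∫ z in {z | ξ < v z}, fderiv ℝ φ z (1, ξ)

/-- Layer-cake decomposition of the entropy balance. -/
theorem integral_layer_cake {Ω : Opens (ℝ × ℝ)} {v : ℝ × ℝ → ℝ} (hv : Measurable v)
    (φ : 𝓓(Ω, ℝ)) {g : ℝ → ℝ} (hg : Integrable g) (hg' : Integrable fun ξ => ξ * g ξ) :
    Integrable (fun z => (∫ ξ in Iio (v z), g ξ) * fderiv ℝ φ z (1, 0)
        + (∫ ξ in Iio (v z), ξ * g ξ) * fderiv ℝ φ z (0, 1)) ∧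
    ∫ z, ((∫ ξ in Iio (v z), g ξ) * fderiv ℝ φ z (1, 0)
        + (∫ ξ in Iio (v z), ξ * g ξ) * fderiv ℝ φ z (0, 1))
      = ∫ ξ, g ξ * superlevelPairing v φ ξ := by
  let F : (ℝ × ℝ) × ℝ → ℝ := {p | p.2 < v p.1}.indicator fun p =>
    fderiv ℝ φ p.1 (1, 0) * g p.2 + fderiv ℝ φ p.1 (0, 1) * (p.2 * g p.2)
  have hms : MeasurableSet {p : (ℝ × ℝ) × ℝ | p.2 < v p.1} :=
    measurableSet_lt measurable_snd (hv.comp measurable_fst)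
  have hF : Integrable F (volume.prod volume) := by
    refine Integrable.indicator ?_ hms
    exact ((integrable_fderiv_testFunction φ _).mul_prod hg).add
      ((integrable_fderiv_testFunction φ _).mul_prod hg')
  have h1 : ∀ z, ∫ ξ, F (z, ξ) = (∫ ξ in Iio (v z), g ξ) * fderiv ℝ φ z (1, 0)
        + (∫ ξ in Iio (v z), ξ * g ξ) * fderiv ℝ φ z (0, 1) := by
    intro z
    have : (fun ξ => F (z, ξ)) = (Iio (v z)).indicator fun ξ =>
        fderiv ℝ φ z (1, 0) * g ξ + fderiv ℝ φ z (0, 1) * (ξ * g ξ) := by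
      ext ξ; simp [F, indicator]
    rw [this, integral_indicator measurableSet_Iio,
      integral_add (hg.integrableOn.const_mul _) (hg'.integrableOn.const_mul _),
      integral_const_mul, integral_const_mul, mul_comm, mul_comm (fderiv ℝ φ z (0, 1))]
  have h2 : ∀ ξ, ∫ z, F (z, ξ) = g ξ * superlevelPairing v φ ξ := by
    intro ξ
    have hm : MeasurableSet {z | ξ < v z} := measurableSet_lt measurable_const hv
    rw [superlevelPairing, ← integral_const_mul, ← integral_indicator hm]
    congr 1; ext z
    simp only [F, indicator, mem_ofPred_eq, fderiv_apply_one_eq φ z ξ]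
    split_ifs <;> ring
  simp_rw [← h1, ← h2]
  exact ⟨hF.integral_prod_left, integral_integral_swap hF⟩

theorem stronglyMeasurable_superlevelPairing {Ω : Opens (ℝ × ℝ)} {v : ℝ × ℝ → ℝ}
    (hv : Measurable v) (φ : 𝓓(Ω, ℝ)) : StronglyMeasurable (superlevelPairing v φ) := by
  have hms : MeasurableSet {p : ℝ × (ℝ × ℝ) | p.1 < v p.2} :=
    measurableSet_lt measurable_fst (hv.comp measurable_snd)
  have hc : ∀ e : ℝ × ℝ, Continuous fun z => fderiv ℝ φ z e := fun e =>
    (φ.contDiff.continuous_fderiv (by simp)).clm_apply continuous_const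
  have h1 : StronglyMeasurable ({p : ℝ × (ℝ × ℝ) | p.1 < v p.2}.indicator fun p =>
      fderiv ℝ φ p.2 (1, 0) + p.1 * fderiv ℝ φ p.2 (0, 1)) := by
    refine StronglyMeasurable.indicator (Continuous.stronglyMeasurable ?_) hms
    exact ((hc _).comp continuous_snd).add (continuous_fst.mul ((hc _).comp continuous_snd))
  have h2 : StronglyMeasurable fun ξ => _ := h1.integral_prod_right' (ν := volume)
  convert! h2 using 1
  ext ξ
  have hm : MeasurableSet {z | ξ < v z} := measurableSet_lt measurable_const hv
  rw [superlevelPairing, ← integral_indicator hm]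
  congr 1; ext z
  simp only [indicator, mem_ofPred_eq, fderiv_apply_one_eq φ z ξ]

theorem locallyIntegrable_superlevelPairing {Ω : Opens (ℝ × ℝ)} {v : ℝ × ℝ → ℝ}
    (hv : Measurable v) (φ : 𝓓(Ω, ℝ)) : LocallyIntegrable (superlevelPairing v φ) := by
  set A := ∫ z, ‖fderiv ℝ φ z (1, 0)‖
  set B := ∫ z, ‖fderiv ℝ φ z (0, 1)‖
  have hc : Continuous fun ξ : ℝ => A + |ξ| * B := by fun_prop
  refine hc.locallyIntegrable.mono
    (stronglyMeasurable_superlevelPairing hv φ).aestronglyMeasurable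
    (Eventually.of_forall fun ξ => ?_)
  have iA := (integrable_fderiv_testFunction φ (1, 0)).norm
  have iB := (integrable_fderiv_testFunction φ (0, 1)).norm
  calc ‖superlevelPairing v φ ξ‖ ≤ ∫ z in {z | ξ < v z}, ‖fderiv ℝ φ z (1, ξ)‖ :=
        norm_integral_le_integral_norm _
    _ ≤ ∫ z, ‖fderiv ℝ φ z (1, ξ)‖ :=
        setIntegral_le_integral (integrable_fderiv_testFunction φ _).norm
          (Eventually.of_forall fun _ => norm_nonneg _)
    _ ≤ ∫ z, (‖fderiv ℝ φ z (1, 0)‖ + |ξ| * ‖fderiv ℝ φ z (0, 1)‖) := by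
        refine integral_mono (integrable_fderiv_testFunction φ _).norm
          (iA.add (iB.const_mul _)) fun z => ?_
        simp only [fderiv_apply_one_eq φ z ξ]
        refine (norm_add_le _ _).trans_eq ?_
        rw [norm_mul, Real.norm_eq_abs ξ]
    _ = A + |ξ| * B := by rw [integral_add iA (iB.const_mul _), integral_const_mul]
    _ ≤ ‖A + |ξ| * B‖ := le_abs_self _

/-- As `ξ'` decreases to ξ the sets `{v > ξ'}` exhaust `{v > ξ}`; from the left they would shrink to
`{v ≥ ξ}` instead. One-sided continuity suffices to pass from almost every ξ to every ξ. -/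
theorem tendsto_superlevelPairing {Ω : Opens (ℝ × ℝ)} {v : ℝ × ℝ → ℝ}
    (hv : Measurable v) (φ : 𝓓(Ω, ℝ)) (ξ : ℝ) :
    Tendsto (superlevelPairing v φ) (𝓝[>] ξ) (𝓝 (superlevelPairing v φ ξ)) := by
  have hm : ∀ ξ, MeasurableSet {z | ξ < v z} := fun ξ => measurableSet_lt measurable_const hv
  have hrw : ∀ ξ, superlevelPairing v φ ξ
      = ∫ z, {z | ξ < v z}.indicator (fun z => fderiv ℝ φ z (1, ξ)) z := fun ξ => by
    rw [superlevelPairing, integral_indicator (hm ξ)]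
  rw [hrw ξ, show superlevelPairing v φ = fun ξ => _ from funext hrw]
  have iA := (integrable_fderiv_testFunction φ (1, 0)).norm
  have iB := (integrable_fderiv_testFunction φ (0, 1)).norm
  refine tendsto_integral_filter_of_dominated_convergence
    (fun z => ‖fderiv ℝ φ z (1, 0)‖ + (|ξ| + 1) * ‖fderiv ℝ φ z (0, 1)‖) ?_ ?_
    (iA.add (iB.const_mul _)) ?_
  · exact Eventually.of_forall fun ξ' =>
      ((integrable_fderiv_testFunction φ _).indicator (hm ξ')).aestronglyMeasurable
  · filter_upwards [Ioo_mem_nhdsGT (show ξ < ξ + 1 by linarith)] with ξ' hlt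
    refine Eventually.of_forall fun z => ?_
    refine (norm_indicator_le_norm_self _ _).trans ?_
    rw [fderiv_apply_one_eq φ z ξ']
    refine (norm_add_le _ _).trans ?_
    rw [norm_mul]
    gcongr
    rw [Real.norm_eq_abs]
    calc |ξ'| = |ξ + (ξ' - ξ)| := by ring_nf
      _ ≤ |ξ| + |ξ' - ξ| := abs_add_le _ _
      _ ≤ |ξ| + 1 := by
        gcongr
        rw [abs_le]
        constructor <;> linarith [hlt.1, hlt.2]
  · refine Eventually.of_forall fun z => ?_
    by_cases hz : ξ < v z
    · have hlim : Tendsto (fun ξ' => fderiv ℝ φ z (1, ξ')) (𝓝[>] ξ) (𝓝 (fderiv ℝ φ z (1, ξ))) := by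
        have : Continuous fun ξ' : ℝ => fderiv ℝ φ z (1, ξ') := by fun_prop
        exact (this.tendsto ξ).mono_left nhdsWithin_le_nhds
      rw [indicator_of_mem (show z ∈ {z | ξ < v z} from hz)]
      refine hlim.congr' ?_
      filter_upwards [Ioo_mem_nhdsGT hz] with ξ' hlt
      rw [indicator_of_mem (show z ∈ {z | ξ' < v z} from hlt.2)]
    · rw [indicator_of_notMem (show z ∉ {z | ξ < v z} from hz)]
      refine tendsto_const_nhds.congr' ?_
      filter_upwards [self_mem_nhdsWithin] with ξ' hlt
      rw [indicator_of_notMem]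
      intro h
      exact hz (lt_trans hlt h)

/-- Every superlevel set `{v > ξ}` of a finite-energy solution is transported with speed `ξ`. -/
theorem superlevelPairing_eq_zero {I J : Opens ℝ} {v : ℝ × ℝ → ℝ} (hv : Measurable v)
    (hv4 : MemLp v 4 (volume.restrict (rect I J : Set (ℝ × ℝ))))
    (hb : IsBurgersSolution (rect I J) v) (hreg : timeSpaceEnergy I J v < ⊤)
    (φ : 𝓓(rect I J, ℝ)) (ξ : ℝ) : superlevelPairing v φ ξ = 0 := by
  have hae : ∀ᵐ ξ : ℝ, superlevelPairing v φ ξ = 0 := by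
    -- The test function in ξ plays the role of `η'`; its primitive from -∞ and that of `ξ h(ξ)`
    -- form the entropy pair.
    refine ae_eq_zero_of_integral_contDiff_smul_eq_zero
      (locallyIntegrable_superlevelPairing hv φ) fun h hh hhc => ?_
    have hxc : Continuous fun x : ℝ => x * h x := continuous_id.mul hh.continuous
    have hi : Integrable h := hh.continuous.integrable_of_hasCompactSupport hhc
    have hi' : Integrable fun x => x * h x :=
      hxc.integrable_of_hasCompactSupport hhc.mul_left
    have hprim : ∀ f : ℝ → ℝ, Continuous f → Integrable f → ∀ x,
        HasDerivAt (fun x => ∫ ξ in Iio x, f ξ) (f x) x := by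
      intro f hf hfi x
      have : (fun x => ∫ ξ in Iio x, f ξ) = fun x => (∫ ξ in (0 : ℝ)..x, f ξ)
          + ∫ ξ in Iic 0, f ξ := by
        ext y
        rw [← intervalIntegral.integral_Iic_sub_Iic hfi.integrableOn hfi.integrableOn,
          integral_Iic_eq_integral_Iio (x := y)]
        ring
      rw [this]
      exact (intervalIntegral.integral_hasDerivAt_right (hf.intervalIntegrable _ _)
        hf.aestronglyMeasurable.stronglyMeasurableAtFilter hf.continuousAt).add_const _
    have h0 := weakPairing_eq_zero_of_contDiff hv hv4 hb hreg hh hhc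
      (hprim h hh.continuous hi) (hprim _ hxc hi') φ
    rw [weakPairing_eq_integral φ (fun _ _ => rfl) (fun _ _ => rfl)] at h0
    simpa only [smul_eq_mul] using (integral_layer_cake hv φ hi hi').2.symm.trans h0
  by_contra hne
  have hev := (tendsto_superlevelPairing hv φ ξ).eventually_ne hne
  obtain ⟨b, hξb, hsub⟩ := mem_nhdsGT_iff_exists_Ioo_subset.1 hev
  have hpos : volume (Ioo ξ b) = 0 := by
    refine measure_mono_null ?_ (ae_iff.1 hae)
    exact fun x hx => hsub hx
  rw [Real.volume_Ioo, ENNReal.ofReal_eq_zero] at hpos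
  linarith [show ξ < b from hξb]

/-- Invariance of the superlevel sets along characteristics. -/
theorem ae_superlevel_translate {Ω : Opens (ℝ × ℝ)} {v : ℝ × ℝ → ℝ} (hv : Measurable v) {ξ : ℝ}
    (hξ : ∀ φ : 𝓓(Ω, ℝ), superlevelPairing v φ ξ = 0) {U : Set (ℝ × ℝ)} (hU : IsOpen U) {τ : ℝ}
    (hUΩ : ∀ z ∈ U, ∀ θ ∈ Icc (0 : ℝ) 1, z + θ • (τ, ξ * τ) ∈ Ω) :
    ∀ᵐ z, z ∈ U → (ξ < v z ↔ ξ < v (z + (τ, ξ * τ))) := by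
  set w : ℝ × ℝ := (τ, ξ * τ) with hw
  have hwτ : w = τ • (1, ξ) := by ext <;> simp [hw, mul_comm]
  let f : ℝ × ℝ → ℝ := {z | ξ < v z}.indicator fun _ => 1
  have hms : MeasurableSet {z | ξ < v z} := measurableSet_lt measurable_const hv
  have hfm : Measurable f := measurable_const.indicator hms
  have hfb : ∀ z, ‖f z‖ ≤ ‖(1 : ℝ)‖ := fun z => norm_indicator_le_norm_self _ _
  have hfl : LocallyIntegrable f :=
    (continuous_const (y := (1 : ℝ))).locallyIntegrable.mono hfm.aestronglyMeasurable
      (Eventually.of_forall hfb)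
  have hfl' : LocallyIntegrable fun z => f (z + w) :=
    (continuous_const (y := (1 : ℝ))).locallyIntegrable.mono
      (hfm.comp (measurable_id.add_const w)).aestronglyMeasurable
      (Eventually.of_forall fun z => hfb _)
  have hmain : ∀ᵐ z, z ∈ U → f (z + w) - f z = 0 := by
    refine hU.ae_eq_zero_of_integral_contDiff_smul_eq_zero
      ((hfl'.sub hfl).locallyIntegrableOn U) fun g hg hgc hgU => ?_
    let ψ : ℝ × ℝ → ℝ := fun y => g (-y)
    have hψ : ContDiff ℝ ∞ ψ := hg.comp contDiff_neg
    have hψc : HasCompactSupport ψ := hgc.comp_homeomorph (Homeomorph.neg _)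
    -- With `ψ(y) = g(-y)` this is `∫ g(z) f(z + θw) dz`. Its derivative in θ is a multiple of the
    -- superlevel pairing with `g` translated by `θw`, admissible because the whole segment stays in
    -- Ω.
    let Φ : ℝ → ℝ := fun θ => mollify ψ f (θ • w)
    have hΦ' : ∀ θ ∈ Icc (0 : ℝ) 1, HasDerivAt Φ 0 θ := by
      intro θ hθ
      have h1 : HasFDerivAt (mollify ψ f) (fderiv ℝ (mollify ψ f) (θ • w)) (θ • w) :=
        ((contDiff_mollify hψ hψc hfl).differentiable (by simp)).differentiableAt.hasFDerivAt
      have h2 : HasDerivAt (fun θ : ℝ => θ • w) w θ := by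
        simpa using (hasDerivAt_id θ).smul_const w
      have h3 : HasDerivAt Φ (fderiv ℝ (mollify ψ f) (θ • w) w) θ :=
        HasFDerivAt.comp_hasDerivAt (f := fun θ : ℝ => θ • w) θ h1 h2
      refine h3.congr_deriv ?_
      have hcl : IsClosed {z | z - θ • w ∈ tsupport g} :=
        (isClosed_tsupport g).preimage (by fun_prop)
      have hts : tsupport (fun z => g (z - θ • w)) ⊆ {z | z - θ • w ∈ tsupport g} :=
        closure_minimal (fun z hz => subset_tsupport g hz) hcl
      let φ : 𝓓(Ω, ℝ) :=
        { toFun := fun z => g (z - θ • w)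
          contDiff' := hg.comp (by fun_prop)
          hasCompactSupport' := hgc.comp_homeomorph (Homeomorph.subRight (θ • w))
          tsupport_subset' := by
            intro z hz
            have := hUΩ _ (hgU (hts hz)) θ hθ
            simpa using this }
      have hφd : ∀ z e, fderiv ℝ φ z e = fderiv ℝ g (z - θ • w) e := by
        intro z e
        have : fderiv ℝ (fun z => g (z - θ • w)) z = fderiv ℝ g (z - θ • w) :=
          fderiv_comp_sub _
        exact congrArg (fun L => L e) this
      have hψd : ∀ z, fderiv ℝ ψ (θ • w - z) w = - (τ * fderiv ℝ φ z (1, ξ)) := by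
        intro z
        have h1 : HasFDerivAt g (fderiv ℝ g (z - θ • w)) (-(θ • w - z)) := by
          rw [neg_sub]
          exact (hg.differentiable (by simp)).differentiableAt.hasFDerivAt
        have h2 : HasFDerivAt ψ _ (θ • w - z) :=
          h1.comp (θ • w - z) (hasFDerivAt_id (𝕜 := ℝ) (θ • w - z)).neg
        rw [h2.fderiv, hφd, ContinuousLinearMap.comp_apply, neg_apply,
          ContinuousLinearMap.id_apply, map_neg, hwτ, map_smul, smul_eq_mul]
      rw [fderiv_mollify hψ hψc hfl, mollify]
      simp_rw [hψd]
      have h0 := hξ φ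
      rw [superlevelPairing, ← integral_indicator hms] at h0
      calc ∫ z, f z * -(τ * fderiv ℝ φ z (1, ξ))
          = ∫ z, (-τ) * {z | ξ < v z}.indicator (fun z => fderiv ℝ φ z (1, ξ)) z := by
            congr 1; ext z
            simp only [f, indicator]
            split_ifs <;> ring
        _ = 0 := by rw [integral_const_mul, h0, mul_zero]
    have hconst : Φ 1 = Φ 0 := by
      have := (convex_Icc (0 : ℝ) 1).norm_image_sub_le_of_norm_hasDerivWithin_le (f := Φ)
        (f' := fun _ => 0) (C := 0) (fun θ hθ => (hΦ' θ hθ).hasDerivWithinAt) (by simp)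
        (left_mem_Icc.2 zero_le_one) (right_mem_Icc.2 zero_le_one)
      rw [zero_mul, norm_le_zero_iff, sub_eq_zero] at this
      exact this
    have e1 : Φ 1 = ∫ z, g z * f (z + w) := by
      simp only [Φ, one_smul, mollify, ψ, neg_sub]
      rw [← integral_add_right_eq_self _ w]
      congr 1; ext z; simp [mul_comm]
    have e0 : Φ 0 = ∫ z, g z * f z := by
      simp only [Φ, zero_smul, mollify, ψ, zero_sub, neg_neg]
      congr 1; ext z; simp [mul_comm]
    have i1 : Integrable fun z => g z * f (z + w) :=
      hfl'.integrable_smul_left_of_hasCompactSupport hg.continuous hgc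
    have i2 : Integrable fun z => g z * f z :=
      hfl.integrable_smul_left_of_hasCompactSupport hg.continuous hgc
    simp only [smul_eq_mul, mul_sub]
    rw [integral_sub i1 i2, ← e1, ← e0, hconst, sub_self]
  filter_upwards [hmain] with z hz hzU
  have h := hz hzU
  simp only [f, indicator, mem_ofPred_eq] at h
  by_cases h1 : ξ < v z <;> by_cases h2 : ξ < v (z + w) <;> simp [h1, h2] at h ⊢

end Kinetic

/-! ### Local boundedness from transport and the fourth moment. -/

section LocalBound

open Filter Topology

/-- If almost every point of a non-null set `A` is moved into `E` by every vector of `R`, then `E`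
is at least as large as `R`. -/
theorem measure_le_of_ae_add_mem {A R E : Set (ℝ × ℝ)} (hA : MeasurableSet A)
    (hR : MeasurableSet R) (hE : MeasurableSet E) (hA0 : volume A ≠ 0)
    (h : ∀ w ∈ R, ∀ᵐ z, z ∈ A → z + w ∈ E) : volume R ≤ volume E := by
  -- Fubini on the exceptional pairs exchanges the quantifiers: some single `z ∈ A` is sent into `E`
  -- by almost every `w ∈ R`, so `z + R` lies in `E` up to a null set.
  let T : Set ((ℝ × ℝ) × (ℝ × ℝ)) := {p | p.1 ∈ R ∧ p.2 ∈ A ∧ p.2 + p.1 ∉ E}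
  have hT : MeasurableSet T := (measurable_fst hR).inter ((measurable_snd hA).inter
    ((measurable_snd.add measurable_fst) hE.compl))
  have hT0 : (volume.prod volume) T = 0 := by
    rw [Measure.measure_prod_null hT]
    refine Eventually.of_forall fun w => ?_
    by_cases hw : w ∈ R
    · refine measure_mono_null ?_ (ae_iff.1 (h w hw))
      intro z hz hz'
      exact hz.2.2 (hz' hz.2.1)
    · have : Prod.mk w ⁻¹' T = ∅ := by
        ext z; simp [T, hw]
      simp [this]
  rw [← Measure.prod_swap, Measure.map_apply measurable_swap hT] at hT0
  have hz := Measure.measure_ae_null_of_prod_null hT0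
  obtain ⟨z, hzA, hz0⟩ : ∃ z ∈ A, volume (Prod.mk z ⁻¹' (Prod.swap ⁻¹' T)) = 0 := by
    by_contra hcon
    push Not at hcon
    refine hA0 (measure_mono_null ?_ (ae_iff.1 hz))
    intro z hz
    exact hcon z hz
  calc volume R ≤ volume ((Prod.mk z ⁻¹' (Prod.swap ⁻¹' T)) ∪ (fun w => z + w) ⁻¹' E) := by
        refine measure_mono fun w hw => ?_
        by_cases hwE : z + w ∈ E
        · exact Or.inr hwE
        · exact Or.inl ⟨hw, hzA, hwE⟩
    _ ≤ volume (Prod.mk z ⁻¹' (Prod.swap ⁻¹' T)) + volume ((fun w => z + w) ⁻¹' E) :=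
        measure_union_le _ _
    _ = volume E := by rw [hz0, zero_add, measure_preimage_add]

/-- The characteristic vectors `(τ, ξ τ)` used in the local bound stay short, and their speed is
comparable to `M`. -/
theorem characteristic_bounds {ρ M τ σ : ℝ} (hM : 1 ≤ M) (hρ : 0 < ρ)
    (hτ : τ ∈ Ioo (3 * ρ / (4 * M)) (ρ / M)) (hσ : σ ∈ Ioo (ρ / 2) (3 * ρ / 4)) :
    0 < τ ∧ τ ≤ ρ ∧ σ ≤ ρ ∧ M / 2 < σ / τ ∧ σ / τ < M := by
  have hM0 : 0 < M := by linarith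
  have h1 : 3 * ρ < τ * (4 * M) := (div_lt_iff₀ (by positivity)).1 hτ.1
  have h2 : τ * M < ρ := (lt_div_iff₀ hM0).1 hτ.2
  have hτ0 : 0 < τ := lt_trans (by positivity) hτ.1
  refine ⟨hτ0, ?_, by linarith [hσ.2], ?_, ?_⟩
  · nlinarith
  · rw [lt_div_iff₀ hτ0]; linarith [hσ.1]
  · rw [div_lt_iff₀ hτ0]; linarith [hσ.2]

/-- A function in `L⁴` whose superlevel sets are transported along characteristics is locally
bounded. -/
theorem exists_ae_abs_le {Ω : Opens (ℝ × ℝ)} {v : ℝ × ℝ → ℝ} (hv : Measurable v)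
    (hv4 : MemLp v 4 (volume.restrict (Ω : Set (ℝ × ℝ))))
    (hξ : ∀ (φ : 𝓓(Ω, ℝ)) (ξ : ℝ), superlevelPairing v φ ξ = 0) {K : Set (ℝ × ℝ)}
    (hK : IsCompact K) (hKΩ : K ⊆ Ω) : ∃ M : ℝ, 0 < M ∧ ∀ᵐ z, z ∈ K → |v z| ≤ M := by
  obtain ⟨r, hr, hKr⟩ := hK.exists_thickening_subset_open Ω.isOpen hKΩ
  set ρ := r / 2 with hρdef
  have hρ : 0 < ρ := by positivity
  set U := Metric.thickening ρ K
  have hU : IsOpen U := Metric.isOpen_thickening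
  have hKU : K ⊆ U := Metric.self_subset_thickening hρ K
  have hUΩ : ∀ z ∈ U, ∀ w : ℝ × ℝ, ‖w‖ ≤ ρ → z + w ∈ Ω := by
    intro z hz w hw
    apply hKr
    obtain ⟨x, hx, hzx⟩ := Metric.mem_thickening_iff.1 hz
    refine Metric.mem_thickening_iff.2 ⟨x, hx, ?_⟩
    calc dist (z + w) x ≤ dist (z + w) z + dist z x := dist_triangle _ _ _
      _ < ρ + ρ := by
        have : dist (z + w) z = ‖w‖ := by rw [dist_eq_norm]; simp
        rw [this]; linarith
      _ = r := by rw [hρdef]; ring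
  set N := ∫⁻ z in (Ω : Set (ℝ × ℝ)), ‖v z‖ₑ ^ 4 with hN
  have hNtop : N ≠ ⊤ := by
    have := (lintegral_rpow_enorm_lt_top_of_eLpNorm_lt_top (by simp) (by simp) hv4.2).ne
    simpa [hN] using this
  -- Chebyshev's inequality on a set of measure `ρ²/(16M)` where `|v| ≥ M/2` would give `M³ρ²/256 ≤
  -- N`; this choice excludes it, since `M ρ² > 256 N` and `M³ ≥ M`.
  set M := 256 * N.toReal / ρ ^ 2 + 1 with hMdef
  have hM1 : 1 ≤ M := by
    have : 0 ≤ 256 * N.toReal / ρ ^ 2 := by positivity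
    linarith
  have hM0 : 0 < M := by linarith
  refine ⟨M, hM0, ?_⟩
  let E : Set (ℝ × ℝ) := {z | z ∈ Ω ∧ M / 2 ≤ |v z|}
  have hvabs : Measurable fun z => |v z| := hv.abs
  have hE : MeasurableSet E := Ω.isOpen.measurableSet.inter
    (measurableSet_le measurable_const hvabs)
  have hEvol : ENNReal.ofReal ((M / 2) ^ 4) * volume E ≤ N := by
    have hsub : E = {z | ENNReal.ofReal ((M / 2) ^ 4) ≤ ‖v z‖ₑ ^ 4} ∩ Ω := by
      ext z
      simp only [E, mem_ofPred_eq, mem_inter_iff, SetLike.mem_coe]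
      rw [and_comm, Real.enorm_eq_ofReal_abs, ← ENNReal.ofReal_pow (abs_nonneg _),
        ENNReal.ofReal_le_ofReal_iff (by positivity),
        pow_le_pow_iff_left₀ (by positivity) (abs_nonneg _) (by norm_num)]
    rw [hsub, ← Measure.restrict_apply
      (measurableSet_le measurable_const (hv.enorm.pow_const 4))]
    exact mul_meas_ge_le_lintegral (hv.enorm.pow_const 4) _
  have hnot : ∀ R : Set (ℝ × ℝ), volume R = ENNReal.ofReal (ρ ^ 2 / (16 * M)) →
      ¬ volume R ≤ volume E := by
    intro R hR hle
    have h1 : ENNReal.ofReal ((M / 2) ^ 4 * (ρ ^ 2 / (16 * M))) ≤ N := by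
      rw [ENNReal.ofReal_mul (by positivity), ← hR]
      exact (mul_le_mul_right hle _).trans hEvol
    rw [ENNReal.ofReal_le_iff_le_toReal hNtop] at h1
    have h2 : (M / 2) ^ 4 * (ρ ^ 2 / (16 * M)) = M ^ 3 * ρ ^ 2 / 256 := by
      field_simp; norm_num
    rw [h2] at h1
    have h3 : M * ρ ^ 2 = 256 * N.toReal + ρ ^ 2 := by
      rw [hMdef]; field_simp
    have h4 : M * ρ ^ 2 ≤ M ^ 3 * ρ ^ 2 := by
      gcongr
      calc M = M ^ 1 := (pow_one M).symm
        _ ≤ M ^ 3 := pow_le_pow_right₀ hM1 (by norm_num)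
    have h5 : 0 < ρ ^ 2 := by positivity
    linarith
  have hchar : ∀ τ ξ : ℝ, |τ| ≤ ρ → |ξ * τ| ≤ ρ →
      ∀ᵐ z, z ∈ U → (ξ < v z ↔ ξ < v (z + (τ, ξ * τ))) := by
    intro τ ξ h1 h2
    refine ae_superlevel_translate hv (fun φ => hξ φ ξ) hU fun z hz θ hθ => ?_
    refine hUΩ z hz _ ?_
    rw [norm_smul, Real.norm_eq_abs, abs_of_nonneg hθ.1]
    calc θ * ‖((τ, ξ * τ) : ℝ × ℝ)‖ ≤ 1 * ρ := by
          gcongr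
          · exact hθ.2
          · exact max_le h1 h2
      _ = ρ := one_mul ρ
  have hvol : ∀ a b : ℝ, b - a = ρ / 4 →
      volume (Ioo (3 * ρ / (4 * M)) (ρ / M) ×ˢ Ioo a b) = ENNReal.ofReal (ρ ^ 2 / (16 * M)) := by
    intro a b hab
    have h0 : ρ / M - 3 * ρ / (4 * M) = ρ / (4 * M) := by field_simp; norm_num
    rw [Measure.volume_eq_prod, Measure.prod_prod, Real.volume_Ioo, Real.volume_Ioo, hab, h0,
      ← ENNReal.ofReal_mul (by positivity)]
    congr 1; field_simp; norm_num
  have hmeas : ∀ a b : ℝ, MeasurableSet (Ioo (3 * ρ / (4 * M)) (ρ / M) ×ˢ Ioo a b) :=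
    fun a b => measurableSet_Ioo.prod measurableSet_Ioo
  have hupper : volume {z | z ∈ K ∧ M < v z} = 0 := by
    by_contra hpos
    refine hnot _ (hvol (ρ / 2) (3 * ρ / 4) (by ring)) ?_
    refine measure_le_of_ae_add_mem (hK.measurableSet.inter
      (measurableSet_lt measurable_const hv)) (hmeas _ _) hE hpos ?_
    rintro ⟨τ, σ⟩ ⟨hτ, hσ⟩
    obtain ⟨hτ0, hτρ, hσρ, hlow, hup⟩ := characteristic_bounds hM1 hρ hτ hσ
    have hσ0 : 0 < σ := lt_trans (by positivity) hσ.1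
    have hmul : σ / τ * τ = σ := div_mul_cancel₀ _ hτ0.ne'
    have := hchar τ (σ / τ) (by rwa [abs_of_pos hτ0]) (by rwa [hmul, abs_of_pos hσ0])
    rw [hmul] at this
    filter_upwards [this] with z hz hzA
    have hzU := hKU hzA.1
    refine ⟨hUΩ z hzU _ (max_le ?_ ?_), ?_⟩
    · simpa [abs_of_pos hτ0] using hτρ
    · simpa [abs_of_pos hσ0] using hσρ
    -- The speed `ξ = σ/τ` lies in `(M/2, M)`: the point starts in `{v > ξ}`, stays there after
    -- translation, and so has `v > M/2`.
    · have := (hz hzU).1 (hup.trans hzA.2)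
      exact le_trans (hlow.le.trans this.le) (le_abs_self _)
  have hlower : volume {z | z ∈ K ∧ v z < -M} = 0 := by
    by_contra hpos
    refine hnot _ (hvol (-(3 * ρ / 4)) (-(ρ / 2)) (by ring)) ?_
    refine measure_le_of_ae_add_mem (hK.measurableSet.inter
      (measurableSet_lt hv measurable_const)) (hmeas _ _) hE hpos ?_
    rintro ⟨τ, σ⟩ ⟨hτ, hσ⟩
    have hσ' : -σ ∈ Ioo (ρ / 2) (3 * ρ / 4) := ⟨by linarith [hσ.2], by linarith [hσ.1]⟩
    obtain ⟨hτ0, hτρ, hσρ, hlow, hup⟩ := characteristic_bounds hM1 hρ hτ hσ'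
    have hσ0 : σ < 0 := by
      have : 0 < ρ / 2 := by positivity
      linarith [hσ'.1]
    have hmul : σ / τ * τ = σ := div_mul_cancel₀ _ hτ0.ne'
    have := hchar τ (σ / τ) (by rwa [abs_of_pos hτ0]) (by rwa [hmul, abs_of_neg hσ0])
    rw [hmul] at this
    rw [neg_div] at hlow hup
    filter_upwards [this] with z hz hzA
    have hzU := hKU hzA.1
    refine ⟨hUΩ z hzU _ (max_le ?_ ?_), ?_⟩
    · simpa [abs_of_pos hτ0] using hτρ
    · simpa [abs_of_neg hσ0] using hσρ
    -- Now the speed lies in `(-M, -M/2)`, and the complement of the superlevel set is what is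
    -- transported.
    · have hz1 : ¬ σ / τ < v z := by
        have h2 : v z < -M := hzA.2
        linarith
      have hz2 : ¬ σ / τ < v (z + (τ, σ)) := fun h => hz1 ((hz hzU).2 h)
      refine le_trans ?_ (neg_le_abs _)
      linarith
  have h1 : ∀ᵐ z, ¬ (z ∈ K ∧ M < v z) := by
    rw [ae_iff]; simpa using hupper
  have h2 : ∀ᵐ z, ¬ (z ∈ K ∧ v z < -M) := by
    rw [ae_iff]; simpa using hlower
  filter_upwards [h1, h2] with z hz1 hz2 hzK
  rw [abs_le]
  exact ⟨not_lt.1 fun h => hz2 ⟨hzK, h⟩, not_lt.1 fun h => hz1 ⟨hzK, h⟩⟩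

end LocalBound

/-! ### General entropy pairs for locally bounded solutions. -/

section Entropies

open Filter Topology

/-- Fundamental theorem of calculus for locally Lipschitz functions, in layer-cake form. -/
theorem LocallyLipschitz.eq_add_integral_Iio {f : ℝ → ℝ} (hf : LocallyLipschitz f) {M x : ℝ}
    (hx : |x| ≤ M) :
    IntegrableOn (deriv f) (Ioc (-M) M) ∧
      f x = f (-M) + ∫ ξ in Iio x, (Ioc (-M) M).indicator (deriv f) ξ := by
  obtain ⟨h1, h2⟩ := abs_le.1 hx
  have hac : ∀ y, AbsolutelyContinuousOnInterval f (-M) y := by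
    intro y
    obtain ⟨C, hC⟩ := (hf.locallyLipschitzOn (s := uIcc (-M) y)).exists_lipschitzOnWith_of_compact
      isCompact_uIcc
    exact hC.absolutelyContinuousOnInterval
  refine ⟨?_, ?_⟩
  · have := (hac M).intervalIntegrable_deriv
    rwa [intervalIntegrable_iff_integrableOn_Ioc_of_le (by linarith)] at this
  · have := (hac x).integral_deriv_eq_sub
    rw [intervalIntegral.integral_of_le h1] at this
    rw [← integral_Iic_eq_integral_Iio, setIntegral_indicator measurableSet_Ioc]
    have hset : Iic x ∩ Ioc (-M) M = Ioc (-M) x := by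
      ext y; simp only [mem_inter_iff, mem_Iic, mem_Ioc]
      constructor
      · rintro ⟨a, b, c⟩; exact ⟨b, a⟩
      · rintro ⟨a, b⟩; exact ⟨b, a, b.trans h2⟩
    rw [hset, this]; ring

/-- If the superlevel sets of a locally bounded function are transported along characteristics, then
every entropy balance holds with equality. -/
theorem weakPairing_entropyPair_eq_zero {Ω : Opens (ℝ × ℝ)} {v : ℝ × ℝ → ℝ} (hv : Measurable v)
    (hξ : ∀ (φ : 𝓓(Ω, ℝ)) (ξ : ℝ), superlevelPairing v φ ξ = 0)
    (hbdd : ∀ K : Set (ℝ × ℝ), IsCompact K → K ⊆ Ω → ∃ M : ℝ, 0 < M ∧ ∀ᵐ z, z ∈ K → |v z| ≤ M)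
    {η q : ℝ → ℝ} (hηq : IsEntropyPair η q) (φ : 𝓓(Ω, ℝ)) :
    weakPairing Ω (fun z => η (v z)) (fun z => q (v z)) φ = 0 := by
  obtain ⟨M, hM, hvM⟩ := hbdd _ φ.hasCompactSupport φ.tsupport_subset
  have hM' : |M| ≤ M := (abs_of_pos hM).le
  -- Truncating to the range of `v` on the support of φ makes the density integrable and leaves only
  -- the constants `η(-M)` and `q(-M)`, which integrate to zero against derivatives of φ.
  set g := (Ioc (-M) M).indicator (deriv η) with hg
  have hgi : Integrable g :=
    (hηq.entropy_lipschitz.eq_add_integral_Iio hM').1.integrable_indicator measurableSet_Ioc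
  have hqg : (Ioc (-M) M).indicator (deriv q) =ᵐ[volume] fun ξ => ξ * g ξ := by
    filter_upwards [hηq.deriv_flux] with ξ h
    by_cases hmem : ξ ∈ Ioc (-M) M
    · simp [hg, hmem, h]
    · simp [hg, hmem]
  have hgi' : Integrable fun ξ => ξ * g ξ :=
    ((hηq.flux_lipschitz.eq_add_integral_Iio hM').1.integrable_indicator
      measurableSet_Ioc).congr hqg
  obtain ⟨hLHS, hzero⟩ := integral_layer_cake hv φ hgi hgi'
  simp only [hξ, mul_zero, integral_zero] at hzero
  rw [weakPairing_eq_integral φ (fun _ _ => rfl) (fun _ _ => rfl)]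
  have iT := integrable_fderiv_testFunction φ (1, 0)
  have iS := integrable_fderiv_testFunction φ (0, 1)
  have hφ1 : ContDiff ℝ 1 φ := φ.contDiff.of_le (by simp)
  calc ∫ z, (η (v z) * fderiv ℝ φ z (1, 0) + q (v z) * fderiv ℝ φ z (0, 1))
      = ∫ z, ((η (-M) * fderiv ℝ φ z (1, 0) + q (-M) * fderiv ℝ φ z (0, 1)) +
          ((∫ ξ in Iio (v z), g ξ) * fderiv ℝ φ z (1, 0)
            + (∫ ξ in Iio (v z), ξ * g ξ) * fderiv ℝ φ z (0, 1))) := by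
        refine integral_congr_ae ?_
        filter_upwards [hvM] with z hz
        by_cases hzK : z ∈ tsupport φ
        · have hb := hz hzK
          rw [(hηq.entropy_lipschitz.eq_add_integral_Iio hb).2,
            (hηq.flux_lipschitz.eq_add_integral_Iio hb).2,
            integral_congr_ae (ae_restrict_of_ae hqg)]
          ring
        · simp [fderiv_testFunction_eq_zero φ hzK]
    _ = 0 := by
        have i0 : Integrable fun z =>
            η (-M) * fderiv ℝ φ z (1, 0) + q (-M) * fderiv ℝ φ z (0, 1) :=
          (iT.const_mul _).add (iS.const_mul _)
        rw [integral_add i0 hLHS, hzero, integral_add (iT.const_mul _) (iS.const_mul _),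
          integral_const_mul, integral_const_mul,
          integral_fderiv_apply_eq_zero hφ1 φ.hasCompactSupport,
          integral_fderiv_apply_eq_zero hφ1 φ.hasCompactSupport]
        simp

theorem isEntropyPair_sq_cube : IsEntropyPair (fun x => x ^ 2 / 2) (fun x => x ^ 3 / 3) := by
  have h2 : ContDiff ℝ 1 fun x : ℝ => x ^ 2 / 2 := by fun_prop
  have h3 : ContDiff ℝ 1 fun x : ℝ => x ^ 3 / 3 := by fun_prop
  refine ⟨h2.locallyLipschitz, h3.locallyLipschitz, Eventually.of_forall fun w => ?_⟩
  simp only [deriv_div_const, deriv_pow_field]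
  norm_num
  ring

/-- Continuous functions of a locally bounded function are locally integrable. -/
theorem MemLInftyLoc.locallyIntegrableOn_comp {Ω : Opens (ℝ × ℝ)} {v : ℝ × ℝ → ℝ}
    (hv : MemLInftyLoc Ω v) {f : ℝ → ℝ} (hf : Continuous f) :
    LocallyIntegrableOn (fun z => f (v z)) (Ω : Set (ℝ × ℝ)) := by
  rw [locallyIntegrableOn_iff Ω.isOpen.isLocallyClosed]
  intro K hKΩ hK
  have hvK := hv K hK hKΩ
  have hfin : IsFiniteMeasure (volume.restrict K) := ⟨by simpa using hK.measure_lt_top⟩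
  have hbd : ∀ᵐ z ∂volume.restrict K, ‖v z‖ ≤ (eLpNormEssSup v (volume.restrict K)).toReal := by
    have hlt : eLpNormEssSup v (volume.restrict K) < ⊤ := by
      simpa using hvK.2
    filter_upwards [enorm_ae_le_eLpNormEssSup v (volume.restrict K)] with z hz
    rw [← ENNReal.ofReal_le_iff_le_toReal hlt.ne, ofReal_norm]
    exact hz
  set M := (eLpNormEssSup v (volume.restrict K)).toReal
  obtain ⟨C, hC⟩ := (isCompact_Icc (a := -M) (b := M)).exists_bound_of_continuousOn hf.continuousOn
  refine Integrable.of_bound (hf.comp_aestronglyMeasurable hvK.1) C ?_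
  filter_upwards [hbd] with z hz
  exact hC _ (abs_le.1 hz)

end Entropies

/-! ### Independence of the almost-everywhere representative. -/

section Representatives

open Filter Topology

/-- The energy does not depend on the representative. -/
theorem timeSpaceEnergy_congr {I J : Opens ℝ} {v v' : ℝ × ℝ → ℝ}
    (h : v =ᵐ[volume.restrict (rect I J : Set (ℝ × ℝ))] v') :
    timeSpaceEnergy I J v = timeSpaceEnergy I J v' := by
  have hprod : (volume.restrict (rect I J : Set (ℝ × ℝ)))
      = (volume.restrict (I : Set ℝ)).prod (volume.restrict (J : Set ℝ)) := by
    rw [Measure.prod_restrict]; rfl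
  rw [hprod] at h
  refine lintegral_congr_ae ?_
  filter_upwards [Measure.ae_ae_of_ae_prod h] with t ht
  have hJ : (volume.restrict ((J : Set ℝ) ×ˢ (J : Set ℝ)))
      = (volume.restrict (J : Set ℝ)).prod (volume.restrict (J : Set ℝ)) := by
    rw [Measure.prod_restrict]; rfl
  rw [hJ]
  refine lintegral_congr_ae ?_
  filter_upwards [Measure.quasiMeasurePreserving_fst.ae ht,
    Measure.quasiMeasurePreserving_snd.ae ht] with p h1 h2
  rw [h1, h2]

theorem weakPairing_congr {Ω : Opens (ℝ × ℝ)} {a b a' b' : ℝ × ℝ → ℝ}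
    (ha : a =ᵐ[volume.restrict (Ω : Set (ℝ × ℝ))] a')
    (hb : b =ᵐ[volume.restrict (Ω : Set (ℝ × ℝ))] b') (φ : 𝓓(Ω, ℝ)) :
    weakPairing Ω a b φ = weakPairing Ω a' b' φ := by
  refine integral_congr_ae ?_
  filter_upwards [ha, hb] with z h1 h2
  rw [h1, h2]

theorem IsBurgersSolution.congr {Ω : Opens (ℝ × ℝ)} {v v' : ℝ × ℝ → ℝ}
    (hv : IsBurgersSolution Ω v) (h : v =ᵐ[volume.restrict (Ω : Set (ℝ × ℝ))] v') :
    IsBurgersSolution Ω v' := by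
  have h2 : (fun z => v z ^ 2 / 2) =ᵐ[volume.restrict (Ω : Set (ℝ × ℝ))] fun z => v' z ^ 2 / 2 := by
    filter_upwards [h] with z hz
    rw [hz]
  have hloc : ∀ {a b : ℝ × ℝ → ℝ}, a =ᵐ[volume.restrict (Ω : Set (ℝ × ℝ))] b →
      LocallyIntegrableOn a (Ω : Set (ℝ × ℝ)) → LocallyIntegrableOn b (Ω : Set (ℝ × ℝ)) := by
    intro a b hab ha
    rw [locallyIntegrableOn_iff Ω.isOpen.isLocallyClosed] at ha ⊢
    intro K hKΩ hK
    exact (ha K hKΩ hK).congr (ae_restrict_of_ae_restrict_of_subset hKΩ hab)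
  exact ⟨hloc h hv.1, hloc h2 hv.2, fun φ => by
    rw [← weakPairing_congr h h2 φ]; exact hv.eq_zero φ⟩

end Representatives

/-! ### Conclusion. -/

theorem mainTheorem5 (I J : Opens ℝ)
    (hI : (I : Set ℝ).OrdConnected) (hJ : (J : Set ℝ).OrdConnected)
    (v : ℝ × ℝ → ℝ)
    (hv4 : MemLp v 4 (volume.restrict (rect I J : Set (ℝ × ℝ))))
    (hburgers : IsBurgersSolution (rect I J) v)
    (hreg : timeSpaceEnergy I J v < ∞) :
    IsEntropySolution (rect I J) v ∧
      WeakBalance (rect I J) (fun z => v z ^ 2 / 2) (fun z => v z ^ 3 / 3) := by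
  -- A Borel representative makes the superlevel sets and the Fubini arguments measurable; the
  -- hypotheses pass to `u` and the conclusions back to `v`.
  obtain ⟨u, hum, hvu⟩ : ∃ u : ℝ × ℝ → ℝ, Measurable u ∧
      v =ᵐ[volume.restrict (rect I J : Set (ℝ × ℝ))] u :=
    ⟨hv4.1.mk v, hv4.1.stronglyMeasurable_mk.measurable, hv4.1.ae_eq_mk⟩
  have hu4 := hv4.ae_eq hvu
  have hureg : timeSpaceEnergy I J u < ⊤ := timeSpaceEnergy_congr hvu ▸ hreg
  have htransport := superlevelPairing_eq_zero hum hu4 (hburgers.congr hvu) hureg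
  have hbdd : ∀ K : Set (ℝ × ℝ), IsCompact K → K ⊆ rect I J →
      ∃ M : ℝ, 0 < M ∧ ∀ᵐ z, z ∈ K → |u z| ≤ M := fun K hK hKΩ =>
    exists_ae_abs_le hum hu4 htransport hK hKΩ
  have hinfty : MemLInftyLoc (rect I J) v := by
    intro K hK hKΩ
    obtain ⟨M, -, hM⟩ := hbdd K hK hKΩ
    have huv := ae_restrict_of_ae_restrict_of_subset hKΩ hvu
    refine memLp_top_of_bound
      (hv4.1.mono_measure (Measure.restrict_mono hKΩ le_rfl)) M ?_
    filter_upwards [huv, (ae_restrict_iff' hK.measurableSet).2 hM] with z h1 h2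
    rw [h1]
    exact h2
  have hpair : ∀ η q : ℝ → ℝ, IsEntropyPair η q → ∀ φ : 𝓓(rect I J, ℝ),
      weakPairing (rect I J) (fun z => η (v z)) (fun z => q (v z)) φ = 0 := by
    intro η q hηq φ
    exact (weakPairing_congr (hvu.fun_comp η) (hvu.fun_comp q) φ).trans
      (weakPairing_entropyPair_eq_zero hum htransport hbdd hηq φ)
  refine ⟨⟨hinfty, hburgers, fun η q hηq _ => ⟨?_, ?_, fun φ _ => (hpair η q hηq φ).ge⟩⟩,
    ⟨?_, ?_, hpair _ _ isEntropyPair_sq_cube⟩⟩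
  · exact hinfty.locallyIntegrableOn_comp hηq.entropy_lipschitz.continuous
  · exact hinfty.locallyIntegrableOn_comp hηq.flux_lipschitz.continuous
  · exact hinfty.locallyIntegrableOn_comp (f := fun x => x ^ 2 / 2) (by fun_prop)
  · exact hinfty.locallyIntegrableOn_comp (f := fun x => x ^ 3 / 3) (by fun_prop)
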